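/- Let $S$ be an algebraic torus over $\mathbb{R}$ with character module $X=X^*(S)$, cocharacter module $X_*(S)$ and dual torus $\widehat S=X\otimes\mathbb{C}^\times$, let $\Gamma=\mathrm{Gal}(\mathbb{C}/\mathbb{R})=\{1,\sigma\}$, and let $W=\mathbb{C}^\times\cup\mathbb{C}^\times j$ (with $jzj^{-1}=\bar z$, $j^2=-1$) be the Weil group of $\mathbb{R}$. Let $\gamma\in\frac12X$ be imaginary, i.e. $2\gamma\neq0$ and $\sigma(2\gamma)=-2\gamma$, and let $R=\{2\gamma,-2\gamma\}$. *Adams–Vogan side.* Let $S(\mathbb{R})_\gamma=\{(s,z)\in S(\mathbb{R})\times\mathbb{C}^\times : (2\gamma)(s)=z^2\}$, and let $\langle\widehat S,\widehat\delta\rangle$ be the extension of $\Gamma$ by $\widehat S$ generated by $\widehat S$ and an element $\widehat\delta$ acting on $\widehat S$ as $\sigma$ with $\widehat\delta^2=\exp(2\pi i\gamma)$. The Adams–Vogan correspondence relates a continuous $L$-homomorphism $\varphi:W\to\langle\widehat S,\widehat\delta\rangle$, written as $\varphi(z)=z^\lambda\bar z^{\sigma\lambda}$, $\varphi(j)=\exp(2\pi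 i\mu)\widehat\delta$ with $\lambda,\mu\in X\otimes\mathbb{C}$, to the genuine character of $S(\mathbb{R})_\gamma$ with differential $\lambda$ whose restriction to the maximal compact subgroup is that of the algebraic character $\kappa=\frac12(1-\sigma)\lambda-(1+\sigma)\mu\in\gamma+X$. *Galois-theoretic side.* Let $S(\mathbb{R})_\pm=\{(s,\delta) : s\in S(\mathbb{R}),\ \delta\in\mathbb{C}^\times/N_{\mathbb{C}/\mathbb{R}}(\mathbb{C}^\times),\ \delta/\bar\delta=(2\gamma)(s)\}$. For a gauge $p$ on $R$ (a function $p:R\to\{\pm1\}$ with $p(-\alpha)=-p(\alpha)$) let ${}^LS_\pm^{(p)}=\widehat S\boxtimes_{t_p}\Gamma$ be the twisted product for the Tits cocycle $t_p(\tau,\tau')=(-1)^{\sum\alpha}$, the sum being over the $\alpha\in R$ with $p(\alpha)=1$, $p(\tau^{-1}\alpha)=-1$, $p((\tau\tau')^{-1}\alpha)=1$; for varying $p$ these groups are identified, up to $\widehat S$-conjugacy, by $s\boxtimes\tau\mapsto s\cdot s_{p/q}(\tau)\boxtimes\tau$, where $s_{p/q}(\tau)=(-1)^{\sum\alpha}$,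 the sum being over the $\alpha\in R$ with $p(\alpha)=1$, $p(\tau^{-1}\alpha)=-1$, $q(\alpha)=q(\tau^{-1}\alpha)=1$ and those with $p(\alpha)=p(\tau^{-1}\alpha)=1$, $q(\alpha)=-1$, $q(\tau^{-1}\alpha)=1$. They define ${}^LS_\pm$. A set of $\chi$-data consists of continuous characters $\chi_\alpha:\mathbb{C}^\times\to\mathbb{C}^\times$, $\alpha\in R$, with $\chi_{\tau\alpha}=\chi_\alpha\circ\tau^{-1}$ for $\tau\in\Gamma$, $\chi_{-\alpha}=\chi_\alpha^{-1}$, and $\chi_\alpha|_{\mathbb{R}^\times}=\mathrm{sgn}$. It gives the genuine character $\chi_S(s,\delta)=\chi_{2\gamma}(\delta)$ of $S(\mathbb{R})_\pm$ and the cochain $r_p(w)=\chi_\alpha(v_0(w_1ww_1^{-1}))^{w_1^{-1}\alpha}$, where $\alpha\in R$ and $w_1\in W$ satisfy $p(w_1^{-1}\alpha)=1$, $v_0\in\mathbb{C}^\times$ and $v_1\in\mathbb{C}^\times j$ are arbitrary, and $v_0(u)\in\mathbb{C}^\times$ is defined by $v_0u=v_0(u)v_k$ with $k\in\{0,1\}$.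 The correspondence relates the genuine character $\theta\cdot\chi_S$, for a continuous character $\theta$ of $S(\mathbb{R})$ with Langlands parameter $t:W\to\widehat S$, to the $\widehat S$-conjugacy class of the parameter $w\mapsto t(w)r_p(w)\boxtimes w$. Here $t$ is a continuous 1-cocycle, and $\theta$ corresponds to pairing with $t$ under Langlands' isomorphism $H_1(W,X_*(S))\cong S(\mathbb{R})$ given by transfer to $\mathbb{C}^\times$. *Claim.* There is an isomorphism of topological groups $S(\mathbb{R})_\gamma\to S(\mathbb{R})_\pm$ given by $(s,z)\mapsto(s,[z])$, and for every gauge $p$ there is an isomorphism of topological groups $\langle\widehat S,\widehat\delta\rangle\to{}^LS_\pm^{(p)}$ over $\Gamma$ which is the identity on $\widehat S$ and sends $\widehat\delta$ to $1\boxtimes\sigma$; for varying $p$ these are compatible, up to $\widehat S$-conjugacy, with the identifications of the groups ${}^LS_\pm^{(p)}$. Under these isomorphisms a continuous genuine character and a Langlands parameter correspond in the sense of Adams–Vogan if and only if they correspond in the second sense, and the latter relation is the same for every choice of $\chi$-data and of $\alpha,w_1,v_0,v_1$. -/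

import Mathlib

open scoped TensorProduct ComplexConjugate

noncomputable section

namespace RealTori

/-- The Galois group of `ℂ / ℝ`. -/
abbrev Gam : Type := Gal(ℂ/ℝ)

/-- Complex conjugation, the non-trivial element of the Galois group. -/
def cc : Gam := Complex.conjAe

theorem gam_cases (g : Gam) : g = 1 ∨ g = cc := by
  rcases Complex.real_algHom_eq_id_or_conj (g : ℂ →ₐ[ℝ] ℂ) with h | h
  · left
    ext z
    exact DFunLike.congr_fun h z
  · right
    ext z
    exact DFunLike.congr_fun h z

theorem cc_ne_one : cc ≠ 1 := by
  intro h
  have h1 : conj Complex.I = Complex.I := DFunLike.congr_fun h Complex.I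
  have h2 := congrArg Complex.im h1
  norm_num at h2

theorem cc_mul_cc : cc * cc = 1 := by
  ext z
  exact Complex.conj_conj z

theorem cc_inv : cc⁻¹ = cc := inv_eq_of_mul_eq_one_left cc_mul_cc

/-! ### Twisted products -/

/-- Normalised 2-cocycles of a group `G` with values in a commutative `G`-group `A`. -/
structure Cocycle2 (G A : Type*) [Group G] [CommGroup A] [MulDistribMulAction G A] where
  toFun : G → G → A
  one_left : ∀ g, toFun 1 g = 1
  one_right : ∀ g, toFun g 1 = 1
  cocycle : ∀ g h k, toFun g h * toFun (g * h) k = (g • toFun h k) * toFun g (h * k)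

/-- The twisted product `A ⊠_t G`; the element `a ⊠ g` is `⟨a, g⟩`. -/
@[ext] structure Tw {G A : Type*} [Group G] [CommGroup A] [MulDistribMulAction G A]
    (t : Cocycle2 G A) where
  left : A
  right : G

namespace Tw

variable {G A : Type*} [Group G] [CommGroup A] [MulDistribMulAction G A] {t : Cocycle2 G A}

instance : Group (Tw t) where
  mul x y := ⟨x.left * (x.right • y.left) * t.toFun x.right y.right, x.right * y.right⟩
  one := ⟨1, 1⟩
  inv x := ⟨(x.right⁻¹ • (x.left * t.toFun x.right x.right⁻¹))⁻¹, x.right⁻¹⟩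
  mul_assoc x y z := by
    refine Tw.ext ?_ (mul_assoc _ _ _)
    change (x.left * x.right • y.left * t.toFun x.right y.right) *
        (x.right * y.right) • z.left * t.toFun (x.right * y.right) z.right =
      x.left * x.right • (y.left * y.right • z.left * t.toFun y.right z.right) *
        t.toFun x.right (y.right * z.right)
    have h := t.cocycle x.right y.right z.right
    simp only [smul_mul', mul_smul]
    calc x.left * x.right • y.left * t.toFun x.right y.right * x.right • y.right • z.left *
          t.toFun (x.right * y.right) z.right
        = x.left * x.right • y.left * x.right • y.right • z.left *
          (t.toFun x.right y.right * t.toFun (x.right * y.right) z.right) := by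
            simp only [mul_assoc, mul_comm, mul_left_comm]
      _ = _ := by rw [h]; simp only [mul_assoc]
  one_mul x := by
    refine Tw.ext ?_ (one_mul _)
    change 1 * (1 : G) • x.left * t.toFun 1 x.right = x.left
    rw [one_smul, one_mul, t.one_left, mul_one]
  mul_one x := by
    refine Tw.ext ?_ (mul_one _)
    change x.left * x.right • (1 : A) * t.toFun x.right 1 = x.left
    rw [smul_one, mul_one, t.one_right, mul_one]
  inv_mul_cancel x := by
    refine Tw.ext ?_ (inv_mul_cancel _)
    change (x.right⁻¹ • (x.left * t.toFun x.right x.right⁻¹))⁻¹ * x.right⁻¹ • x.left *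
      t.toFun x.right⁻¹ x.right = 1
    have h := t.cocycle x.right⁻¹ x.right x.right⁻¹
    rw [inv_mul_cancel, mul_inv_cancel, t.one_left, t.one_right, mul_one, mul_one] at h
    rw [smul_mul', h]
    group

theorem mul_def (x y : Tw t) :
    x * y = ⟨x.left * (x.right • y.left) * t.toFun x.right y.right, x.right * y.right⟩ := rfl

theorem one_def : (1 : Tw t) = ⟨1, 1⟩ := rfl

theorem inv_def (x : Tw t) :
    x⁻¹ = ⟨(x.right⁻¹ • (x.left * t.toFun x.right x.right⁻¹))⁻¹, x.right⁻¹⟩ := rfl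

/-- The topology of the product `A × G`. -/
instance [TopologicalSpace A] [TopologicalSpace G] : TopologicalSpace (Tw t) :=
  TopologicalSpace.induced (fun x => (x.left, x.right)) inferInstance

end Tw

open Classical in
/-- The 2-cocycle of the Galois group of `ℂ / ℝ` with value `y` at `(cc, cc)` and `1` elsewhere,
for an invariant element `y`. In `Tw (cyclicCocycle y hy)` the element `⟨1, cc⟩` acts on
`A` by conjugation as `cc` does, and its square is `y`. -/
def cyclicCocycle {A : Type*} [CommGroup A] [MulDistribMulAction Gam A] (y : A)
    (hy : ∀ g : Gam, g • y = y) : Cocycle2 Gam A where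
  toFun g h := if g = cc ∧ h = cc then y else 1
  one_left g := by simp [cc_ne_one.symm]
  one_right g := by simp [cc_ne_one.symm]
  cocycle g h k := by
    rcases gam_cases g with rfl | rfl <;> rcases gam_cases h with rfl | rfl <;>
      rcases gam_cases k with rfl | rfl <;>
      simp [cc_ne_one.symm, cc_mul_cc, hy]

/-- The Weil group of `ℝ`: generated by `ℂˣ` and `j` with `j z j⁻¹ = conj z` and `j² = -1`. -/
abbrev Weil : Type :=
  Tw (cyclicCocycle (-1 : ℂˣ) (fun g => Units.ext (by simp)))

/-- The element `j` of the Weil group. -/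
def wj : Weil := ⟨1, cc⟩

/-- The element `z` of `ℂˣ` as an element of the Weil group. -/
def wz (z : ℂˣ) : Weil := ⟨z, 1⟩

/-- `v 0, v 1` are representatives of the two right cosets of `ℂˣ` in the Weil group. -/
structure CosetReps where
  v : Fin 2 → Weil
  right_zero : (v 0).right = 1
  right_one : (v 1).right = cc

/-- The representatives `1, j`. -/
def stdReps : CosetReps where
  v := ![1, wj]
  right_zero := rfl
  right_one := rfl

open Classical in
/-- For `u` in the Weil group and `i = 0, 1`, the element `v_i(u)` of `ℂˣ` determined by
`v_i * u = v_i(u) * v_{i'}`. Here `i' = i` if `u ∈ ℂˣ` and `i' = 1 - i` otherwise. -/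
def CosetReps.part (V : CosetReps) (i : Fin 2) (u : Weil) : ℂˣ :=
  (V.v i * u * (V.v (if u.right = 1 then i else 1 - i))⁻¹).left

/-! ### Tori

A torus `S` over `ℝ` is given by its character module `X = X^*(S)`, a finitely generated free
abelian group with an action of the Galois group of `ℂ / ℝ`. -/

/-- The group `Hom(M, ℂˣ)` of homomorphisms from an additive group `M` to `ℂˣ`. -/
@[ext] structure CharGrp (M : Type*) [AddCommGroup M] where
  toFun : M → ℂˣ
  map_add' : ∀ x y, toFun (x + y) = toFun x * toFun y

namespace CharGrp

variable {M : Type*} [AddCommGroup M]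

instance : FunLike (CharGrp M) M ℂˣ where
  coe := toFun
  coe_injective _ _ h := CharGrp.ext h

theorem ext_apply {f g : CharGrp M} (h : ∀ x, f x = g x) : f = g := CharGrp.ext (funext h)

theorem map_add (f : CharGrp M) (x y : M) : f (x + y) = f x * f y := f.map_add' x y

theorem map_zero (f : CharGrp M) : f 0 = 1 := by
  have h := f.map_add 0 0
  rw [add_zero] at h
  exact left_eq_mul.mp h

theorem map_neg (f : CharGrp M) (x : M) : f (-x) = (f x)⁻¹ := by
  rw [eq_inv_iff_mul_eq_one, ← f.map_add, neg_add_cancel, f.map_zero]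

instance : CommGroup (CharGrp M) where
  mul f g := ⟨fun x => f x * g x, fun x y => by rw [f.map_add, g.map_add, mul_mul_mul_comm]⟩
  one := ⟨fun _ => 1, fun _ _ => (one_mul 1).symm⟩
  inv f := ⟨fun x => (f x)⁻¹, fun x y => by rw [f.map_add, mul_inv]⟩
  mul_assoc f g h := ext_apply fun x => mul_assoc (f x) (g x) (h x)
  one_mul f := ext_apply fun x => one_mul (f x)
  mul_one f := ext_apply fun x => mul_one (f x)
  inv_mul_cancel f := ext_apply fun x => inv_mul_cancel (f x)
  mul_comm f g := ext_apply fun x => mul_comm (f x) (g x)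

theorem mul_apply (f g : CharGrp M) (x : M) : (f * g) x = f x * g x := rfl

theorem one_apply (x : M) : (1 : CharGrp M) x = 1 := rfl

theorem inv_apply (f : CharGrp M) (x : M) : f⁻¹ x = (f x)⁻¹ := rfl

/-- The topology of pointwise convergence. -/
instance : TopologicalSpace (CharGrp M) :=
  TopologicalSpace.induced (fun f x => f x) inferInstance

end CharGrp

section Torus

variable (X : Type*) [AddCommGroup X]

/-- The group `S(ℂ) = Hom(X^*(S), ℂˣ)`. -/
abbrev CPoints : Type _ := CharGrp X

/-- The cocharacter module `X_*(S)`. -/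
abbrev Cochar : Type _ := X →+ ℤ

/-- The dual torus `Hom(X_*(S), ℂˣ) = X^*(S) ⊗ ℂˣ`. -/
abbrev DualTorus : Type _ := CharGrp (X →+ ℤ)

variable [DistribMulAction Gam X]

/-- The group `S(ℝ)` of Galois invariant points in `S(ℂ)`. -/
def RPoints : Subgroup (CPoints X) where
  carrier := {s | ∀ (g : Gam) (x : X), s (g • x) = g • s x}
  one_mem' := fun g _ => (smul_one g).symm
  mul_mem' := by
    intro s s' hs hs' g x
    simp only [Set.mem_ofPred_eq] at hs hs'
    rw [CharGrp.mul_apply, CharGrp.mul_apply, hs, hs', smul_mul']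
  inv_mem' := by
    intro s hs g x
    simp only [Set.mem_ofPred_eq] at hs
    rw [CharGrp.inv_apply, CharGrp.inv_apply, hs, smul_inv']

variable {X}

/-- The Galois action on the cocharacter module. -/
def coact (g : Gam) (ξ : Cochar X) : Cochar X :=
  ξ.comp (DistribSMul.toAddMonoidHom X g⁻¹)

theorem coact_apply (g : Gam) (ξ : Cochar X) (x : X) : coact g ξ x = ξ (g⁻¹ • x) := rfl

theorem coact_add (g : Gam) (ξ η : Cochar X) : coact g (ξ + η) = coact g ξ + coact g η := rfl

theorem coact_zero (g : Gam) : coact g (0 : Cochar X) = 0 := rfl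

theorem coact_one (ξ : Cochar X) : coact 1 ξ = ξ := by
  ext x; simp [coact_apply]

theorem coact_mul (g h : Gam) (ξ : Cochar X) : coact (g * h) ξ = coact g (coact h ξ) := by
  ext x; simp [coact_apply, mul_smul]

/-- The algebraic action of the Galois group on the dual torus. -/
instance : MulDistribMulAction Gam (DualTorus X) where
  smul g b :=
    { toFun := fun ξ => b (coact g⁻¹ ξ)
      map_add' := fun ξ η => by rw [coact_add, CharGrp.map_add] }
  one_smul b := by
    refine CharGrp.ext_apply fun ξ => ?_
    change b (coact 1⁻¹ ξ) = b ξ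
    rw [inv_one, coact_one]
  mul_smul g h b := by
    refine CharGrp.ext_apply fun ξ => ?_
    change b (coact (g * h)⁻¹ ξ) = b (coact h⁻¹ (coact g⁻¹ ξ))
    rw [mul_inv_rev, coact_mul]
  smul_one g := rfl
  smul_mul g b b' := rfl

theorem smul_dual_apply (g : Gam) (b : DualTorus X) (ξ : Cochar X) :
    (g • b) ξ = b (coact g⁻¹ ξ) := rfl

end Torus

section Maps

variable {X : Type*} [AddCommGroup X]

/-- The element `x ⊗ z`, also written `z ^ x`, of the dual torus. -/
def zpowDual (z : ℂˣ) (x : X) : DualTorus X where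
  toFun ξ := z ^ (ξ x)
  map_add' ξ η := by simp [zpow_add]

theorem zpowDual_neg_one (x : X) : zpowDual (-1) (-x) = zpowDual (-1) x := by
  refine CharGrp.ext_apply fun ξ => ?_
  change (-1 : ℂˣ) ^ (ξ (-x)) = (-1) ^ ξ x
  rw [map_neg, zpow_neg, ← inv_zpow, inv_neg, inv_one]

theorem zpowDual_zero (z : ℂˣ) : zpowDual z (0 : X) = 1 := by
  refine CharGrp.ext_apply fun ξ => ?_
  change z ^ (ξ 0) = 1
  simp

/-- The element `ξ(z)` of `S(ℂ)`, for a cocharacter `ξ`. -/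
def cocharPt (ξ : Cochar X) (z : ℂˣ) : CPoints X where
  toFun x := z ^ (ξ x)
  map_add' x y := by simp [zpow_add]

/-- The exponential as a map `ℂ → ℂˣ`. -/
def expU (w : ℂ) : ℂˣ := Units.mk0 (Complex.exp w) (Complex.exp_ne_zero w)

theorem expU_add (v w : ℂ) : expU (v + w) = expU v * expU w := Units.ext (Complex.exp_add v w)

/-- The pairing of `X^*(S) ⊗ ℂ` with `Hom(X^*(S), ℂ)`, sending `c ⊗ x` and `H` to `c * H x`. -/
def pairing (H : X →+ ℂ) : ℂ ⊗[ℤ] X →+ ℂ :=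
  (TensorProduct.lift ((LinearMap.mul ℤ ℂ).compl₂ H.toIntLinearMap)).toAddMonoidHom

theorem pairing_tmul (H : X →+ ℂ) (c : ℂ) (x : X) : pairing H (c ⊗ₜ x) = c * H x := rfl

theorem pairing_add (H H' : X →+ ℂ) (v : ℂ ⊗[ℤ] X) :
    pairing (H + H') v = pairing H v + pairing H' v := by
  induction v with
  | zero => simp
  | tmul c x => simp [pairing_tmul, mul_add]
  | add v w hv hw => simp only [map_add, hv, hw]; ring

/-- A cocharacter as an element of `Hom(X^*(S), ℂ)`. -/
def castC (ξ : Cochar X) : X →+ ℂ := (Int.castAddHom ℂ).comp ξ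

theorem castC_apply (ξ : Cochar X) (x : X) : castC ξ x = (ξ x : ℂ) := rfl

/-- The exponential map from the Lie algebra `X^*(S) ⊗ ℂ` of the dual torus to the dual torus. -/
def expDual (v : ℂ ⊗[ℤ] X) : DualTorus X where
  toFun ξ := expU (pairing (castC ξ) v)
  map_add' ξ η := by
    have h : castC (ξ + η) = castC ξ + castC η := by ext x; simp [castC_apply]
    rw [h, pairing_add, expU_add]

/-- The element `γ = a / 2` of `X^*(S) ⊗ ℂ`. -/
def half (a : X) : ℂ ⊗[ℤ] X := (1 / 2 : ℂ) ⊗ₜ[ℤ] a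

theorem expDual_half (a : X) :
    expDual ((2 * Real.pi * Complex.I : ℂ) • half a) = zpowDual (-1) a := by
  refine CharGrp.ext_apply fun ξ => ?_
  apply Units.ext
  change Complex.exp (pairing (castC ξ) ((2 * Real.pi * Complex.I : ℂ) • half a)) =
    (((-1 : ℂˣ) ^ ξ a : ℂˣ) : ℂ)
  rw [half, TensorProduct.smul_tmul', pairing_tmul, castC_apply, smul_eq_mul]
  rw [show 2 * Real.pi * Complex.I * (1 / 2) * (ξ a : ℂ) = (ξ a : ℂ) * (Real.pi * Complex.I) by
    ring, Complex.exp_int_mul, Complex.exp_pi_mul_I]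
  simp

variable [DistribMulAction Gam X]

/-- The Galois action on `X^*(S) ⊗ ℂ` through the first factor `X^*(S)`. -/
def actC (g : Gam) : ℂ ⊗[ℤ] X →ₗ[ℤ] ℂ ⊗[ℤ] X :=
  LinearMap.lTensor ℂ (DistribSMul.toAddMonoidHom X g).toIntLinearMap

end Maps

/-! ### The local Langlands correspondence for tori -/

section Langlands

variable {X : Type*} [AddCommGroup X] [DistribMulAction Gam X]

/-- Continuous 1-cocycles of the Weil group in the dual torus. -/
def IsCocycle1 (t : Weil → DualTorus X) : Prop :=
  Continuous t ∧ ∀ w w' : Weil, t (w * w') = t w * w.right • t w'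

/-- 1-cycles of the Weil group with values in `X_*(S)`: finitely supported functions `c` with
`∑ (w⁻¹ - 1) c(w) = 0`. -/
def IsCycle1 (c : Weil →₀ Cochar X) : Prop :=
  (c.sum fun w ξ => coact w.right⁻¹ ξ - ξ) = 0

/-- The transfer of a 1-cycle of the Weil group with values in `X_*(S)` to a 1-cycle of `ℂˣ`,
regarded as an element of `ℂˣ ⊗ X_*(S) = S(ℂ)`. On 1-cycles it induces Langlands' isomorphism
of the first homology of the Weil group with `S(ℝ)`. -/
def transfer (c : Weil →₀ Cochar X) : CPoints X :=
  c.prod fun w ξ => ∏ i : Fin 2,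
    cocharPt (coact (stdReps.v i).right ξ) (stdReps.part i w)

/-- The 1-cocycle `t` is a Langlands parameter of the character `θ` of `S(ℝ)`: under the
isomorphism of `S(ℝ)` with the first homology of the Weil group with values in `X_*(S)`, the
character `θ` is the pairing with `t`. -/
def IsTorusParameter (θ : RPoints X →* ℂˣ) (t : Weil → DualTorus X) : Prop :=
  IsCocycle1 t ∧
    ∀ c : Weil →₀ Cochar X, IsCycle1 c → ∀ s : RPoints X, (s : CPoints X) = transfer c →
      θ s = c.prod fun w ξ => t w ξ

end Langlands

/-! ### The Galois-theoretic double cover, its `L`-group, and its local correspondence -/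

section Symmetric

variable {X : Type*} [AddCommGroup X] [DistribMulAction Gam X]

/-- The character `a` is symmetric, i.e. imaginary: `-a ≠ a`, and `-a` lies in the Galois orbit
of `a`. -/
def IsSymmetric (a : X) : Prop := -a ≠ a ∧ ∃ g : Gam, g • a = -a

theorem IsSymmetric.cc_smul {a : X} (h : IsSymmetric a) : cc • a = -a := by
  obtain ⟨h1, g, hg⟩ := h
  rcases gam_cases g with rfl | rfl
  · exact absurd (by rw [← hg, one_smul]) h1
  · exact hg

theorem IsSymmetric.ne_zero {a : X} (h : IsSymmetric a) : a ≠ 0 := by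
  rintro rfl
  exact h.1 neg_zero

variable (X) in
/-- Finite admissible subsets of `X^*(S)` stable under the Galois group and under negation. -/
structure AdmissibleSet where
  carrier : Finset X
  neg_mem : ∀ b ∈ carrier, -b ∈ carrier
  smul_mem : ∀ (g : Gam), ∀ b ∈ carrier, g • b ∈ carrier
  zero_notMem : (0 : X) ∉ carrier

open Classical in
/-- The admissible set `{a, -a}` for a symmetric `a`. -/
def pmSet (a : X) (ha : IsSymmetric a) : AdmissibleSet X where
  carrier := {a, -a}
  neg_mem b hb := by
    simp only [Finset.mem_insert, Finset.mem_singleton] at hb ⊢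
    rcases hb with rfl | rfl <;> simp
  smul_mem g b hb := by
    simp only [Finset.mem_insert, Finset.mem_singleton] at hb ⊢
    rcases gam_cases g with rfl | rfl <;> rcases hb with rfl | rfl <;>
      simp [ha.cc_smul]
  zero_notMem := by
    simp only [Finset.mem_insert, Finset.mem_singleton, not_or]
    exact ⟨ha.ne_zero.symm, fun h => ha.ne_zero (neg_eq_zero.mp h.symm)⟩

/-- Gauges on `R`. Only the values on `R` matter. -/
structure Gauge (R : AdmissibleSet X) where
  toFun : X → ℤˣ
  neg : ∀ b ∈ R.carrier, toFun (-b) = -toFun b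

open Classical in
/-- The set of `b ∈ R` with `p(b) = 1`, `p(g⁻¹ b) = -1`, `p((g h)⁻¹ b) = 1`. -/
def titsSet (R : AdmissibleSet X) (p : Gauge R) (g h : Gam) : Finset X :=
  R.carrier.filter fun b =>
    p.toFun b = 1 ∧ p.toFun (g⁻¹ • b) = -1 ∧ p.toFun ((g * h)⁻¹ • b) = 1

theorem titsSet_eq_empty (R : AdmissibleSet X) (p : Gauge R) (g h : Gam) (hgh : g = 1 ∨ h = 1) :
    titsSet R p g h = ∅ := by
  unfold titsSet
  rw [Finset.filter_eq_empty_iff]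
  rintro b - ⟨h1, h2, h3⟩
  rcases hgh with rfl | rfl
  · rw [inv_one, one_smul, h1] at h2
    exact absurd h2 (by decide)
  · rw [mul_one, h2] at h3
    exact absurd h3 (by decide)

theorem zpowDual_smul (z : ℂˣ) (x : X) (g : Gam) :
    g • zpowDual z x = zpowDual z (g • x) := by
  refine CharGrp.ext_apply fun ξ => ?_
  rw [smul_dual_apply]
  change z ^ (coact g⁻¹ ξ x) = z ^ ξ (g • x)
  rw [coact_apply, inv_inv]

open Classical in
theorem cc_smul_titsSum (R : AdmissibleSet X) (p : Gauge R) :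
    cc • (∑ b ∈ titsSet R p cc cc, b) = -∑ b ∈ titsSet R p cc cc, b := by
  rw [Finset.smul_sum, ← Finset.sum_neg_distrib]
  have hcc : ∀ b : X, cc • cc • b = b := fun b => by rw [← mul_smul, cc_mul_cc, one_smul]
  refine Finset.sum_bij' (fun b _ => -(cc • b)) (fun b _ => -(cc • b)) ?_ ?_ ?_ ?_ ?_
  · intro b hb
    simp only [titsSet, Finset.mem_filter, cc_inv, cc_mul_cc, inv_one, one_smul] at hb ⊢
    obtain ⟨hR, h1, h2, -⟩ := hb
    have hcR := R.smul_mem cc b hR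
    rw [smul_neg, hcc, p.neg _ hcR, p.neg _ hR, h1, h2]
    exact ⟨R.neg_mem _ hcR, by simp⟩
  · intro b hb
    simp only [titsSet, Finset.mem_filter, cc_inv, cc_mul_cc, inv_one, one_smul] at hb ⊢
    obtain ⟨hR, h1, h2, -⟩ := hb
    have hcR := R.smul_mem cc b hR
    rw [smul_neg, hcc, p.neg _ hcR, p.neg _ hR, h1, h2]
    exact ⟨R.neg_mem _ hcR, by simp⟩
  · intro b _
    simp [hcc]
  · intro b _
    simp [hcc]
  · intro b _
    simp

/-- The Tits cocycle `t_p(g, h) = (-1) ^ ∑ b`, the sum being over `titsSet R p g h`. -/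
def titsCocycle (R : AdmissibleSet X) (p : Gauge R) : Cocycle2 Gam (DualTorus X) where
  toFun g h := zpowDual (-1) (∑ b ∈ titsSet R p g h, b)
  one_left g := by rw [titsSet_eq_empty R p _ _ (Or.inl rfl), Finset.sum_empty, zpowDual_zero]
  one_right g := by rw [titsSet_eq_empty R p _ _ (Or.inr rfl), Finset.sum_empty, zpowDual_zero]
  cocycle g h k := by
    have h1 : ∀ g, zpowDual (-1) (∑ b ∈ titsSet R p 1 g, b) = 1 := fun g => by
      rw [titsSet_eq_empty R p _ _ (Or.inl rfl), Finset.sum_empty, zpowDual_zero]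
    have h2 : ∀ g, zpowDual (-1) (∑ b ∈ titsSet R p g 1, b) = 1 := fun g => by
      rw [titsSet_eq_empty R p _ _ (Or.inr rfl), Finset.sum_empty, zpowDual_zero]
    rcases gam_cases g with rfl | rfl
    · rw [one_mul, h1, h1, one_smul, one_mul, mul_one]
    · rcases gam_cases h with rfl | rfl
      · rw [mul_one, one_mul, h1, h2, smul_one]
      · rcases gam_cases k with rfl | rfl
        · rw [mul_one, h2, h2, smul_one, one_mul, mul_one]
        · rw [cc_mul_cc, h1, h2, zpowDual_smul, cc_smul_titsSum, zpowDual_neg_one]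

/-- The `L`-group of the double cover, in its Galois form, with respect to the gauge `p`. -/
abbrev LGroup (R : AdmissibleSet X) (p : Gauge R) : Type _ := Tw (titsCocycle R p)

open Classical in
/-- The cochain `s_{p/q}(g) = (-1) ^ ∑ b`, the sum being over the disjoint union of the
two sets below. -/
def gaugeCochain (R : AdmissibleSet X) (p q : Gauge R) (g : Gam) : DualTorus X :=
  zpowDual (-1)
    ((∑ b ∈ R.carrier.filter fun b => p.toFun b = 1 ∧ p.toFun (g⁻¹ • b) = -1 ∧
        q.toFun b = 1 ∧ q.toFun (g⁻¹ • b) = 1, b) +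
      ∑ b ∈ R.carrier.filter fun b => p.toFun b = 1 ∧ p.toFun (g⁻¹ • b) = 1 ∧
        q.toFun b = -1 ∧ q.toFun (g⁻¹ • b) = 1, b)

/-- The transition map `s ⊠ g ↦ s * s_{p/q}(g) ⊠ g` between the `L`-groups for two gauges. -/
def gaugeChange (R : AdmissibleSet X) (p q : Gauge R) (x : LGroup R p) : LGroup R q :=
  ⟨x.left * gaugeCochain R p q x.right, x.right⟩

/-- The subgroup of norms from `ℂˣ` to `ℝˣ`, as a subgroup of `ℂˣ`. -/
def normGroup : Subgroup ℂˣ where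
  carrier := {d | ∃ w : ℂˣ, d = w * cc • w}
  one_mem' := ⟨1, by simp⟩
  mul_mem' := by
    rintro _ _ ⟨v, rfl⟩ ⟨w, rfl⟩
    exact ⟨v * w, by rw [smul_mul']; exact mul_mul_mul_comm _ _ _ _⟩
  inv_mem' := by
    rintro _ ⟨w, rfl⟩
    exact ⟨w⁻¹, by rw [smul_inv', mul_inv]⟩

/-- The homomorphism `d ↦ d / conj d` on `ℂˣ` modulo norms. With `α` symmetric this is the double
cover of `J_α(ℝ) = ℂ¹`, because `F_α = ℂ` and `F_{±α} = ℝ`. -/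
def angle : ℂˣ ⧸ normGroup →* ℂˣ :=
  QuotientGroup.lift normGroup
    { toFun := fun d => d / cc • d
      map_one' := by simp
      map_mul' := fun d d' => by rw [smul_mul', mul_div_mul_comm] }
    (by
      rintro _ ⟨w, rfl⟩
      change (w * cc • w) / cc • (w * cc • w) = 1
      rw [smul_mul', ← mul_smul, cc_mul_cc, one_smul, mul_comm w, div_self'])

/-- The double cover `S(ℝ)_±` of `S(ℝ)` for the set `{a, -a}`, a single symmetric orbit: the
pull-back of the double cover `ℂˣ / N(ℂˣ) → ℂ¹` along `a : S(ℝ) → ℂ¹`. Its elements are the pairs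
`(s, δ)` with `δ / conj δ = a(s)`. -/
def PMCover (a : X) : Subgroup (CPoints X × (ℂˣ ⧸ normGroup)) where
  carrier := {y | y.1 ∈ RPoints X ∧ angle y.2 = y.1 a}
  one_mem' := ⟨one_mem _, map_one angle⟩
  mul_mem' := by
    rintro x y ⟨h1, h2⟩ ⟨h3, h4⟩
    exact ⟨mul_mem h1 h3, by
      rw [Prod.snd_mul, Prod.fst_mul, map_mul, CharGrp.mul_apply, h2, h4]⟩
  inv_mem' := by
    rintro x ⟨h1, h2⟩
    exact ⟨inv_mem h1, by
      rw [Prod.snd_inv, Prod.fst_inv, map_inv, CharGrp.inv_apply, h2]⟩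

/-- The projection `S(ℝ)_± → S(ℝ)`. -/
def PMCover.proj (a : X) : PMCover a →* RPoints X where
  toFun y := ⟨y.1.1, y.2.1⟩
  map_one' := rfl
  map_mul' _ _ := rfl

/-- The non-trivial element of the kernel of `S(ℝ)_± → S(ℝ)`. -/
def PMCover.eps (a : X) : PMCover a :=
  ⟨(1, QuotientGroup.mk (-1)), one_mem _, by
    change (-1 : ℂˣ) / cc • (-1 : ℂˣ) = (1 : CPoints X) a
    have h : cc • (-1 : ℂˣ) = -1 := Units.ext (by simp)
    rw [h, div_self', CharGrp.one_apply]⟩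

/-- Continuous genuine characters of `S(ℝ)_±`. -/
def PMCover.IsGenuine {a : X} (θ : PMCover a →* ℂˣ) : Prop :=
  Continuous θ ∧ θ (PMCover.eps a) = -1

/-- The inclusion of `ℝˣ` in `ℂˣ`. -/
def realUnit (r : ℝˣ) : ℂˣ := Units.map Complex.ofRealHom.toMonoidHom r

open Classical in
/-- The sign character of `ℝˣ`. -/
def kappa (r : ℝˣ) : ℂˣ := if 0 < (r : ℝ) then 1 else -1

/-- A set of χ-data for a set `R` all of whose elements `b` are symmetric, so that
`F_b = ℂ` and `F_{±b} = ℝ`. -/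
structure ChiData (R : AdmissibleSet X) where
  chi : X → (ℂˣ →* ℂˣ)
  cont : ∀ b ∈ R.carrier, Continuous (chi b)
  smul : ∀ (g : Gam), ∀ b ∈ R.carrier, ∀ z, chi (g • b) z = chi b (g⁻¹ • z)
  neg : ∀ b ∈ R.carrier, ∀ z, chi (-b) z = (chi b z)⁻¹
  real : ∀ b ∈ R.carrier, ∀ r : ℝˣ, chi b (realUnit r) = kappa r

theorem mem_pmSet (a : X) (ha : IsSymmetric a) : a ∈ (pmSet a ha).carrier := by
  simp [pmSet]

theorem ChiData.norm_trivial {R : AdmissibleSet X} (D : ChiData R) {b : X} (hb : b ∈ R.carrier) :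
    normGroup ≤ (D.chi b).ker := by
  rintro _ ⟨w, rfl⟩
  have hpos : 0 < Complex.normSq (w : ℂ) := Complex.normSq_pos.mpr w.ne_zero
  have h : w * cc • w = realUnit (Units.mk0 _ hpos.ne') := by
    apply Units.ext
    change (w : ℂ) * conj (w : ℂ) = ((Complex.normSq (w : ℂ) : ℝ) : ℂ)
    exact Complex.mul_conj _
  rw [MonoidHom.mem_ker, h, D.real b hb]
  simp [kappa, hpos]

/-- The genuine character `χ_S` of `S(ℝ)_±` attached to χ-data. -/
def chiS (a : X) (ha : IsSymmetric a) (D : ChiData (pmSet a ha)) : PMCover a →* ℂˣ where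
  toFun y := QuotientGroup.lift normGroup (D.chi a) (D.norm_trivial (mem_pmSet a ha)) y.1.2
  map_one' := by simp
  map_mul' x y := by simp

/-- The choices in the definition of the cochain `r_p` for the single orbit `{a, -a}`:
a representative `b` of the orbit, a representative `w1` of the only coset of `W_{±b} = W` in `W`,
and representatives `v_0, v_1` of the cosets of `W_b = ℂˣ` in `W_{±b} = W`. They determine the
gauge through `p(w1⁻¹ b) = 1`. -/
structure ParamChoice (R : AdmissibleSet X) (p : Gauge R) where
  b : X
  mem : b ∈ R.carrier
  w1 : Weil
  V : CosetReps
  gauge : p.toFun (w1.right⁻¹ • b) = 1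

/-- The 1-cochain `r_p(w) = χ_b(v_0(u(w))) ^ (w1⁻¹ b)`, where `w1 * w = u(w) * w1`. -/
def rp {R : AdmissibleSet X} {p : Gauge R} (D : ChiData R) (C : ParamChoice R p) (w : Weil) :
    DualTorus X :=
  zpowDual (D.chi C.b (C.V.part 0 (C.w1 * w * C.w1⁻¹))) (C.w1.right⁻¹ • C.b)

/-- Langlands parameters valued in an extension of the Galois group by the dual torus. -/
def IsLParameter {t : Cocycle2 Gam (DualTorus X)} (φ : Weil →* Tw t) : Prop :=
  Continuous φ ∧ ∀ w, (φ w).right = w.right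

/-- The local correspondence between genuine characters of `S(ℝ)_±` and Langlands parameters
for the gauge `p`, computed with given χ-data and given choices: the character `θ₀ * χ_S`
corresponds to the class, up to conjugation under the dual torus, of the parameter
`w ↦ t(w) * r_p(w) ⊠ w`, where `t` is a Langlands parameter of the character `θ₀` of `S(ℝ)`. -/
def PMCorrWith (a : X) (ha : IsSymmetric a) (p : Gauge (pmSet a ha)) (D : ChiData (pmSet a ha))
    (C : ParamChoice (pmSet a ha) p) (θ : PMCover a →* ℂˣ)
    (φ : Weil →* LGroup (pmSet a ha) p) : Prop :=
  ∃ (θ₀ : RPoints X →* ℂˣ) (t : Weil → DualTorus X) (d : DualTorus X),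
    Continuous θ₀ ∧ IsTorusParameter θ₀ t ∧
    (∀ y, θ y = θ₀ (PMCover.proj a y) * chiS a ha D y) ∧
    ∀ w : Weil, φ w = ⟨d, 1⟩ * ⟨t w * rp D C w, w.right⟩ * ⟨d, 1⟩⁻¹

/-- The local correspondence between genuine characters of `S(ℝ)_±` and Langlands parameters
for the gauge `p`: it is computed with some χ-data and some choices. -/
def PMCorr (a : X) (ha : IsSymmetric a) (p : Gauge (pmSet a ha)) (θ : PMCover a →* ℂˣ)
    (φ : Weil →* LGroup (pmSet a ha) p) : Prop :=
  ∃ (D : ChiData (pmSet a ha)) (C : ParamChoice (pmSet a ha) p), PMCorrWith a ha p D C θ φ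

/-! ### The Adams-Vogan cover, its `L`-group, and its local correspondence

The element `γ` of `½ X^*(S)` is given by `a = 2γ` in `X^*(S)`. -/

/-- The complex points of `S_γ`: the pairs `(s, z)` with `a(s) = z²`. -/
def AVComplex (a : X) : Subgroup (CPoints X × ℂˣ) where
  carrier := {y | y.1 a = y.2 ^ 2}
  one_mem' := (one_pow 2).symm
  mul_mem' := by
    intro x y h1 h2
    simp only [Set.mem_ofPred_eq] at h1 h2 ⊢
    rw [Prod.snd_mul, Prod.fst_mul, CharGrp.mul_apply, h1, h2, mul_pow]
  inv_mem' := by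
    intro x h1
    simp only [Set.mem_ofPred_eq] at h1 ⊢
    rw [Prod.snd_inv, Prod.fst_inv, CharGrp.inv_apply, h1, inv_pow]

/-- The Adams-Vogan cover `S(ℝ)_γ`, the preimage of `S(ℝ)` in `S_γ(ℂ)`. -/
def AVCover (a : X) : Subgroup (CPoints X × ℂˣ) :=
  AVComplex a ⊓ (RPoints X).comap (MonoidHom.fst _ _)

/-- The Lie algebra of `S(ℝ)`: the Galois invariants in `Hom(X^*(S), ℂ)`. -/
def IsRealLie (H : X →+ ℂ) : Prop := ∀ (g : Gam) (x : X), H (g • x) = g (H x)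

/-- The exponential map `Hom(X^*(S), ℂ) → S(ℂ)`. -/
def expS (H : X →+ ℂ) : CPoints X where
  toFun x := expU (H x)
  map_add' x y := by rw [map_add, expU_add]

theorem smul_expU (g : Gam) (w : ℂ) : g • expU w = expU (g w) := by
  apply Units.ext
  rcases gam_cases g with rfl | rfl
  · rfl
  · exact (Complex.exp_conj w).symm

/-- The exponential map of the Adams-Vogan cover: `H ↦ (exp H, e ^ γ(H))`. -/
def expAV (a : X) (H : X →+ ℂ) (hH : IsRealLie H) : AVCover a :=
  ⟨(expS H, expU (pairing H (half a))), by
    change expU (H a) = expU (pairing H (half a)) ^ 2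
    rw [pow_two, ← expU_add, half, pairing_tmul]
    congr 1
    ring, by
    intro g x
    change expU (H (g • x)) = g • expU (H x)
    rw [hH, smul_expU]⟩

theorem expDual_half_invariant {a : X} (ha : IsSymmetric a) (g : Gam) :
    g • expDual ((2 * Real.pi * Complex.I : ℂ) • half a) =
      expDual ((2 * Real.pi * Complex.I : ℂ) • half a) := by
  rw [expDual_half, zpowDual_smul]
  rcases gam_cases g with rfl | rfl
  · rw [one_smul]
  · rw [ha.cc_smul, zpowDual_neg_one]

/-- The Adams-Vogan `L`-group of `S(ℝ)_γ`: generated by the dual torus and an element `δ̂`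
which acts on the dual torus as complex conjugation does and has square `exp(2πiγ)`. -/
abbrev EGroup (a : X) (ha : IsSymmetric a) : Type _ :=
  Tw (cyclicCocycle (expDual ((2 * Real.pi * Complex.I : ℂ) • half a))
    (expDual_half_invariant ha))

/-- The generator `δ̂` of the Adams-Vogan `L`-group. -/
def delta (a : X) (ha : IsSymmetric a) : EGroup a ha := ⟨1, cc⟩

/-- The genuine character `θ` of `S(ℝ)_γ` is the character `χ(l, κ)` with differential `l` and
with restriction to the maximal compact subgroup equal to that of `κ = γ + k`. -/
def IsAVCharacter (a : X) (θ : AVCover a →* ℂˣ) (l : ℂ ⊗[ℤ] X) (k : X) : Prop :=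
  (∀ (H : X →+ ℂ) (hH : IsRealLie H), θ (expAV a H hH) = expU (pairing H l)) ∧
    ∀ y : AVCover a, (∀ x : X, ‖((y.1.1 x : ℂˣ) : ℂ)‖ = 1) → θ y = y.1.2 * y.1.1 k

/-- The Adams-Vogan local correspondence. A parameter `φ` is of the form
`φ(z) = z ^ l * conj(z) ^ (σ l)` and `φ(j) = exp(2πi m) δ̂`, with `σ` complex conjugation acting
on `X^*(S)`; then `κ = ½ (1 - σ) l - (1 + σ) m` lies in `γ + X^*(S)`, and `φ` corresponds to the
genuine character `χ(l, κ)`. -/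
def AVCorr (a : X) (ha : IsSymmetric a) (θ : AVCover a →* ℂˣ) (φ : Weil →* EGroup a ha) : Prop :=
  ∃ (l m : ℂ ⊗[ℤ] X) (k : X),
    (∀ w : ℂ, φ (wz (expU w)) = ⟨expDual (w • l + conj w • actC cc l), 1⟩) ∧
    φ wj = ⟨expDual ((2 * Real.pi * Complex.I : ℂ) • m), 1⟩ * delta a ha ∧
    half a + (1 : ℂ) ⊗ₜ[ℤ] k = (1 / 2 : ℂ) • (l - actC cc l) - (m + actC cc m) ∧
    IsAVCharacter a θ l k

end Symmetric

end RealTori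

end

/-! The covers are identified by `(s, z) ↦ (s, [z])`, with inverse `(s, [δ]) ↦ (s, δ / |δ|)`: as
`2γ` is imaginary it has absolute value `1` on `S(ℝ)`, so `z` lies on the unit circle
(`coverEquiv`). The two `L`-groups have the same underlying set, and even the same cocycle, because
for every gauge the Tits cocycle takes the value `(-1) ^ (2γ) = exp (2πiγ)` at the pair of
conjugations (`lGroupEquiv`). The cochains comparing two gauges are trivial
(`gaugeCochain_eq_one`).

The comparison of the correspondences reduces both of them to one family of explicit characters. For
`l` in `X ⊗ ℂ` and `k` in `X` let `polarChar l k` be the character `s ↦ |s| ^ l * (s / |s|) ^ k`.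
Suppose a cochain on the Weil group is given by `z ↦ z ^ l * conj z ^ (σ l)` and `j ↦ exp (2πi m)`.

* If it is a cocycle then `k = ½ (1 - σ) l - (1 + σ) m` is integral, and a character of `S(ℝ)` has
  this cocycle as its Langlands parameter if and only if it is the restriction of `polarChar l k`
  (`isTorusParameter_iff`). This comes from evaluating `polarChar l k` at the transfer of an
  arbitrary cycle (`polarChar_transfer`), and from the surjectivity of the transfer
  (`exists_transfer_eq`).
* If it is a genuine parameter then `½ (1 - σ) l - (1 + σ) m = γ + k` with `k` integral
  (`IsLParameter.exists_differential`), and a genuine character of the Adams-Vogan cover corresponds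
  to it if and only if it is `(s, z) ↦ z * polarChar l k s` (`isAVCharacter_iff`).

The character `χ_{2γ}` is an odd power `z ↦ (z / |z|) ^ (2N + 1)` (`exists_odd_of_sign_character`).
Hence `χ_S` is `(s, z) ↦ z * (2γ)(s) ^ N` on the Adams-Vogan cover (`chiS_coverEquiv`), and `r_p` is
the cochain with `l = (2N + 1) γ` and with `m` a multiple of `γ`, which `1 + σ` annihilates. So
division of the character by `χ_S` and of the parameter by `r_p` both change `k` into `k - 2Nγ`.
Conjugation under the dual torus changes `m` by an element annihilated by `1 + σ`, so it has no
effect on the character. No choice enters except through `N`, and `N` cancels. -/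

noncomputable section

namespace RealTori

/-! ### Continuous characters of `ℂ` -/

theorem expU_coe (w : ℂ) : (expU w : ℂ) = Complex.exp w := rfl

theorem expU_zero : expU 0 = 1 := Units.ext Complex.exp_zero

theorem expU_neg (w : ℂ) : expU (-w) = (expU w)⁻¹ := by
  rw [eq_inv_iff_mul_eq_one, ← expU_add, neg_add_cancel, expU_zero]

theorem expU_sub (v w : ℂ) : expU (v - w) = expU v / expU w := by
  rw [sub_eq_add_neg, expU_add, expU_neg, div_eq_mul_inv]

theorem expU_int_mul (n : ℤ) (w : ℂ) : expU (n * w) = expU w ^ n :=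
  Units.ext (by rw [expU_coe, Complex.exp_int_mul, Units.val_zpow_eq_zpow_val, expU_coe])

theorem expU_pi_mul_I : expU (Real.pi * Complex.I) = -1 :=
  Units.ext (by rw [expU_coe, Complex.exp_pi_mul_I]; rfl)

theorem expU_eq_expU_iff {v w : ℂ} :
    expU v = expU w ↔ ∃ n : ℤ, v = w + n * (2 * Real.pi * Complex.I) := by
  rw [Units.ext_iff, expU_coe, expU_coe, Complex.exp_eq_exp_iff_exists_int]

theorem expU_log (z : ℂˣ) : expU (Complex.log z) = z := Units.ext (Complex.exp_log z.ne_zero)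

theorem exists_expU_eq (z : ℂˣ) : ∃ w, expU w = z := ⟨_, expU_log z⟩

theorem continuous_expU : Continuous expU :=
  Units.continuous_iff.mpr ⟨Complex.continuous_exp, by
    have h : (fun w => ((expU w)⁻¹ : ℂˣ).val) = fun w => Complex.exp (-w) := by
      funext w; rw [← expU_neg, expU_coe]
    change Continuous (fun w => ((expU w)⁻¹ : ℂˣ).val)
    rw [h]; fun_prop⟩

/-- A continuous homomorphism from `ℂ` to `ℂˣ` lifts through the exponential to an `ℝ`-linear map,
so it has the form `w ↦ exp (α w + β conj w)`. -/
theorem exists_expU_of_continuous_hom (f : ℂ → ℂˣ) (hf : Continuous f)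
    (hadd : ∀ v w, f (v + w) = f v * f w) :
    ∃ α β : ℂ, ∀ w, f w = expU (α * w + β * conj w) := by
  have h0 : f 0 = 1 := by
    have h := hadd 0 0
    rw [add_zero] at h
    exact left_eq_mul.mp h
  obtain ⟨F, ⟨hF0, hF⟩, -⟩ := Complex.isCoveringMapOn_exp.existsUnique_continuousMap_lifts
    (⟨fun w => (f w : ℂ), Units.continuous_val.comp hf⟩ : C(ℂ, ℂ)) (a₀ := 0) (e₀ := 0)
    (by simp [h0]) (fun w => (f w).ne_zero)
  have hF' : ∀ w, expU (F w) = f w := fun w => Units.ext (congrFun hF w)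
  -- The defect of additivity is continuous with values in the discrete set `2πiℤ`.
  have hFadd : ∀ v w, F (v + w) = F v + F w := by
    intro v w
    have hn : ∀ w, ∃ n : ℤ, F (v + w) - F v - F w = n * (2 * Real.pi * Complex.I) := fun w => by
      obtain ⟨n, hn⟩ := expU_eq_expU_iff.mp
        (show expU (F (v + w)) = expU (F v + F w) by rw [expU_add, hF', hF', hF', hadd])
      exact ⟨n, by rw [hn]; ring⟩
    choose n hn using hn
    have hcont : Continuous n := by
      have h1 : Continuous fun w => (n w : ℝ) := by
        have h2 : (fun w => (n w : ℝ)) =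
            fun w => ((F (v + w) - F v - F w) / (2 * Real.pi * Complex.I)).re := by
          funext w
          rw [hn, mul_div_cancel_right₀ _ Complex.two_pi_I_ne_zero, Complex.intCast_re]
        rw [h2]
        fun_prop
      exact Int.isClosedEmbedding_coe_real.isEmbedding.continuous_iff.mpr h1
    have hc := PreconnectedSpace.constant (inferInstance : PreconnectedSpace ℂ) hcont (x := w)
      (y := 0)
    have h1 := hn 0
    rw [add_zero, hF0, sub_self, sub_zero] at h1
    have h2 := hn w
    rw [hc, ← h1, sub_sub, sub_eq_zero] at h2
    exact h2
  let G : ℂ →L[ℝ] ℂ := (AddMonoidHom.mk' F hFadd).toRealLinearMap F.continuous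
  refine ⟨(G 1 - Complex.I * G Complex.I) / 2, (G 1 + Complex.I * G Complex.I) / 2, fun w => ?_⟩
  rw [← hF']
  congr 1
  have hw : w = w.re • (1 : ℂ) + w.im • Complex.I := by
    simp [Complex.re_add_im]
  have h1 : F w = w.re * G 1 + w.im * G Complex.I := by
    change G w = _
    conv_lhs => rw [hw]
    rw [_root_.map_add, map_smul, map_smul]
    simp
  rw [h1]
  have h2 : w = w.re + w.im * Complex.I := (Complex.re_add_im w).symm
  have h3 : conj w = w.re - w.im * Complex.I := by
    rw [Complex.ext_iff]; simp
  rw [h3]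
  conv_rhs => rw [show w = w.re + w.im * Complex.I from h2]
  simp only [Complex.add_re, Complex.ofReal_re, Complex.mul_re, Complex.I_re, Complex.add_im,
    Complex.ofReal_im, Complex.mul_im, Complex.I_im, mul_zero, mul_one, zero_add, add_zero,
    sub_zero]
  ring_nf
  rw [Complex.I_sq]
  ring

theorem eq_zero_of_expU_real_mul {c : ℂ} (h : ∀ r : ℝ, expU (r * c) = 1) : c = 0 := by
  have h1 : HasDerivAt (fun r : ℝ => Complex.exp (r * c)) (Complex.exp ((0 : ℝ) * c) * (1 * c)) 0 :=
    ((Complex.ofRealCLM.hasDerivAt (x := (0 : ℝ))).mul_const c).cexp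
  have h2 : (fun r : ℝ => Complex.exp (r * c)) = fun _ => 1 :=
    funext fun r => congrArg Units.val (h r)
  rw [h2] at h1
  have h3 := h1.unique (hasDerivAt_const _ _)
  simpa using h3

/-- The coefficients of a continuous character of `ℂ` are unique. -/
theorem eq_zero_of_expU_eq_one {α β : ℂ} (h : ∀ w, expU (α * w + β * conj w) = 1) :
    α = 0 ∧ β = 0 := by
  have h1 : α + β = 0 := eq_zero_of_expU_real_mul fun r => by
    rw [← h r, Complex.conj_ofReal]; congr 1; ring
  have h2 : (α - β) * Complex.I = 0 := eq_zero_of_expU_real_mul fun r => by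
    rw [← h (r * Complex.I), map_mul, Complex.conj_ofReal, Complex.conj_I]; congr 1; ring
  have h3 : α - β = 0 := (mul_eq_zero.mp h2).resolve_right Complex.I_ne_zero
  constructor
  · linear_combination (h1 + h3) / 2
  · linear_combination (h1 - h3) / 2

/-- A continuous character of `ℂˣ` which restricts to the sign character of `ℝˣ` is an odd power
of `z ↦ z / |z|`. -/
theorem exists_odd_of_sign_character (χ : ℂˣ →* ℂˣ) (hχ : Continuous χ)
    (hr : ∀ r : ℝˣ, χ (realUnit r) = kappa r) :
    ∃ N : ℤ, ∀ w, χ (expU w) = expU ((2 * N + 1) * ((w - conj w) / 2)) := by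
  obtain ⟨α, β, h⟩ := exists_expU_of_continuous_hom (fun w => χ (expU w))
    (hχ.comp continuous_expU) (fun v w => by rw [expU_add, map_mul])
  have h1 : α + β = 0 := eq_zero_of_expU_real_mul fun r => by
    have h2 : expU r = realUnit (Units.mk0 (Real.exp r) (Real.exp_ne_zero r)) :=
      Units.ext (Complex.ofReal_exp r).symm
    have h3 := h r
    simp only [h2, hr] at h3
    rw [kappa, if_pos (by exact Real.exp_pos r), Complex.conj_ofReal] at h3
    rw [h3]; congr 1; ring
  have h4 : expU (α * (Real.pi * Complex.I) + β * conj (Real.pi * Complex.I)) =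
      expU (Real.pi * Complex.I) := by
    rw [← h]
    have h5 : (-1 : ℂˣ) = realUnit (-1) := Units.ext (by simp [realUnit])
    simp only [expU_pi_mul_I]
    rw [h5, hr, kappa, if_neg (by simp), ← h5]
  obtain ⟨N, hN⟩ := expU_eq_expU_iff.mp h4
  have hβ : β = -α := by linear_combination h1
  rw [map_mul, Complex.conj_ofReal, Complex.conj_I, hβ] at hN
  have hpi : (Real.pi * Complex.I : ℂ) ≠ 0 :=
    mul_ne_zero (Complex.ofReal_ne_zero.mpr Real.pi_ne_zero) Complex.I_ne_zero
  have hα : 2 * α = 2 * N + 1 := mul_right_cancel₀ hpi (by linear_combination hN)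
  refine ⟨N, fun w => ?_⟩
  rw [h w, hβ, ← hα]
  congr 1
  ring

/-! ### The Lie algebra of the dual torus and its exponential map -/

namespace CharGrp

variable {M : Type*} [AddCommGroup M]

theorem map_sum {ι : Type*} (f : CharGrp M) (s : Finset ι) (g : ι → M) :
    f (∑ i ∈ s, g i) = ∏ i ∈ s, f (g i) := by
  classical
  induction s using Finset.induction_on with
  | empty => simp [f.map_zero]
  | insert i s hi ih => rw [Finset.sum_insert hi, Finset.prod_insert hi, f.map_add, ih]

theorem map_zsmul (f : CharGrp M) (n : ℤ) (x : M) : f (n • x) = f x ^ n := by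
  let F : M →+ Additive ℂˣ := ⟨⟨fun x => Additive.ofMul (f x), f.map_zero⟩, f.map_add⟩
  exact _root_.map_zsmul F n x

theorem prod_apply {ι : Type*} (s : Finset ι) (g : ι → CharGrp M) (x : M) :
    (∏ i ∈ s, g i) x = ∏ i ∈ s, g i x := by
  classical
  induction s using Finset.induction_on with
  | empty => rfl
  | insert i s hi ih => rw [Finset.prod_insert hi, Finset.prod_insert hi, mul_apply, ih]

theorem div_apply (f g : CharGrp M) (x : M) : (f / g) x = f x / g x := by
  rw [div_eq_mul_inv, div_eq_mul_inv, mul_apply, inv_apply]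

theorem continuous_apply (x : M) : Continuous fun f : CharGrp M => f x :=
  (_root_.continuous_apply x).comp continuous_induced_dom

theorem continuous_of_apply {T : Type*} [TopologicalSpace T] {f : T → CharGrp M}
    (h : ∀ x, Continuous fun t => f t x) : Continuous f :=
  continuous_induced_rng.mpr (continuous_pi h)

end CharGrp

section Pairing

variable {X : Type*} [AddCommGroup X]

theorem pairing_smul (H : X →+ ℂ) (c : ℂ) (v : ℂ ⊗[ℤ] X) : pairing H (c • v) = c * pairing H v := by
  induction v with
  | zero => simp
  | tmul d x => rw [TensorProduct.smul_tmul', pairing_tmul, pairing_tmul, smul_eq_mul, mul_assoc]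
  | add v w hv hw => rw [smul_add, map_add, map_add, hv, hw, mul_add]

theorem pairing_zero (v : ℂ ⊗[ℤ] X) : pairing (0 : X →+ ℂ) v = 0 := by
  have h := pairing_add (0 : X →+ ℂ) 0 v
  rw [add_zero] at h
  exact left_eq_add.mp h

theorem pairing_one_tmul (H : X →+ ℂ) (x : X) : pairing H (1 ⊗ₜ x) = H x := by
  rw [pairing_tmul, one_mul]

theorem pairing_half (H : X →+ ℂ) (x : X) : pairing H (half x) = H x / 2 := by
  rw [half, pairing_tmul]; ring

theorem expDual_apply (v : ℂ ⊗[ℤ] X) (ξ : Cochar X) :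
    expDual v ξ = expU (pairing (castC ξ) v) := rfl

theorem expDual_add (v w : ℂ ⊗[ℤ] X) : expDual (v + w) = expDual v * expDual w :=
  CharGrp.ext_apply fun ξ => by
    rw [CharGrp.mul_apply, expDual_apply, expDual_apply, expDual_apply, map_add, expU_add]

theorem expDual_sub (v w : ℂ ⊗[ℤ] X) : expDual (v - w) = expDual v / expDual w := by
  rw [eq_div_iff_mul_eq', ← expDual_add, sub_add_cancel]

theorem expDual_smul_half (c : ℂ) (a : X) : expDual ((2 * c) • half a) = zpowDual (expU c) a := by
  refine CharGrp.ext_apply fun ξ => ?_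
  rw [expDual_apply, pairing_smul, pairing_half, castC_apply]
  change _ = expU c ^ (ξ a)
  rw [← expU_int_mul]
  congr 1
  ring

theorem zpowDual_one (x : X) : zpowDual 1 x = 1 := CharGrp.ext_apply fun ξ => one_zpow (ξ x)

theorem zpowDual_mul (z w : ℂˣ) (x : X) : zpowDual (z * w) x = zpowDual z x * zpowDual w x :=
  CharGrp.ext_apply fun ξ => mul_zpow z w (ξ x)

theorem zpowDual_inv (z : ℂˣ) (x : X) : zpowDual z⁻¹ x = (zpowDual z x)⁻¹ :=
  CharGrp.ext_apply fun ξ => inv_zpow z (ξ x)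

theorem zpowDual_neg (z : ℂˣ) (x : X) : zpowDual z (-x) = zpowDual z⁻¹ x :=
  CharGrp.ext_apply fun ξ => by
    change z ^ ξ (-x) = z⁻¹ ^ ξ x
    rw [map_neg, zpow_neg, inv_zpow]

theorem continuous_zpowDual (x : X) : Continuous fun z => zpowDual z x :=
  CharGrp.continuous_of_apply fun ξ => continuous_zpow (ξ x)

section Basis

variable {ι : Type*} (b : Module.Basis ι ℤ X)

/-- The cocharacter dual to a member of a basis of the character module. -/
def dualCochar (i : ι) : Cochar X := (b.coord i).toAddMonoidHom

theorem dualCochar_apply (i : ι) (x : X) : dualCochar b i x = b.repr x i := rfl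

variable [Fintype ι]

theorem sum_dualCochar (x : X) : ∑ i, dualCochar b i x • b i = x := b.sum_repr x

theorem sum_map_dualCochar (H : X →+ ℂ) (x : X) : ∑ i, H (b i) * (dualCochar b i x : ℂ) = H x := by
  conv_rhs => rw [← sum_dualCochar b x, map_sum]
  exact Finset.sum_congr rfl fun i _ => by rw [map_zsmul, zsmul_eq_mul, mul_comm]

theorem cochar_eq_sum (ξ : Cochar X) : ξ = ∑ i, ξ (b i) • dualCochar b i := by
  ext x
  rw [AddMonoidHom.finsetSum_apply]
  conv_lhs => rw [← sum_dualCochar b x, map_sum]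
  exact Finset.sum_congr rfl fun i _ => by
    rw [map_zsmul, AddMonoidHom.zsmul_apply, smul_eq_mul, smul_eq_mul, mul_comm]

theorem sum_pairing_dualCochar (v : ℂ ⊗[ℤ] X) :
    ∑ i, (pairing (castC (dualCochar b i)) v) ⊗ₜ[ℤ] b i = v := by
  induction v with
  | zero => simp
  | tmul c x =>
    conv_rhs => rw [← sum_dualCochar b x, TensorProduct.tmul_sum]
    exact Finset.sum_congr rfl fun i _ => by
      rw [pairing_tmul, castC_apply, ← TensorProduct.smul_tmul, zsmul_eq_mul, mul_comm]
  | add v w hv hw =>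
    conv_rhs => rw [← hv, ← hw, ← Finset.sum_add_distrib]
    exact Finset.sum_congr rfl fun i _ => by rw [map_add, TensorProduct.add_tmul]

theorem dualTorus_ext {s s' : DualTorus X} (h : ∀ i, s (dualCochar b i) = s' (dualCochar b i)) :
    s = s' :=
  CharGrp.ext_apply fun ξ => by
    rw [cochar_eq_sum b ξ, s.map_sum, s'.map_sum]
    exact Finset.prod_congr rfl fun i _ => by rw [s.map_zsmul, s'.map_zsmul, h]

theorem pairing_sum_tmul [DecidableEq ι] (α : ι → ℂ) (i : ι) :
    pairing (castC (dualCochar b i)) (∑ j, α j ⊗ₜ[ℤ] b j) = α i := by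
  rw [map_sum, Finset.sum_eq_single i]
  · simp [pairing_tmul, castC_apply, dualCochar_apply]
  · intro j _ hj
    simp [pairing_tmul, castC_apply, dualCochar_apply, hj]
  · simp

end Basis

variable [Module.Free ℤ X] [Module.Finite ℤ X]

theorem eq_of_pairing_castC {v w : ℂ ⊗[ℤ] X}
    (h : ∀ ξ : Cochar X, pairing (castC ξ) v = pairing (castC ξ) w) : v = w := by
  rw [← sum_pairing_dualCochar (Module.Free.chooseBasis ℤ X) v,
    ← sum_pairing_dualCochar (Module.Free.chooseBasis ℤ X) w]
  exact Finset.sum_congr rfl fun i _ => by rw [h]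

theorem expDual_surjective (s : DualTorus X) : ∃ v, expDual v = s := by
  classical
  let b := Module.Free.chooseBasis ℤ X
  choose α hα using fun i => exists_expU_eq (s (dualCochar b i))
  exact ⟨∑ j, α j ⊗ₜ[ℤ] b j, dualTorus_ext b fun i => by
    rw [expDual_apply, pairing_sum_tmul, hα]⟩

/-- The kernel of `v ↦ exp (2πi v)` is the character module. -/
theorem exists_eq_one_tmul_of_expDual_eq_one {v : ℂ ⊗[ℤ] X}
    (h : expDual ((2 * Real.pi * Complex.I : ℂ) • v) = 1) : ∃ k : X, v = (1 : ℂ) ⊗ₜ[ℤ] k := by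
  let b := Module.Free.chooseBasis ℤ X
  have h1 : ∀ i, ∃ n : ℤ, pairing (castC (dualCochar b i)) v = n := fun i => by
    have h2 : expU (pairing (castC (dualCochar b i)) ((2 * Real.pi * Complex.I : ℂ) • v)) =
        expU 0 := by rw [← expDual_apply, h, expU_zero]; rfl
    obtain ⟨n, hn⟩ := expU_eq_expU_iff.mp h2
    rw [pairing_smul, zero_add, mul_comm] at hn
    exact ⟨n, mul_right_cancel₀ Complex.two_pi_I_ne_zero hn⟩
  choose n hn using h1
  refine ⟨∑ i, n i • b i, ?_⟩
  rw [← sum_pairing_dualCochar b v, TensorProduct.tmul_sum]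
  exact Finset.sum_congr rfl fun i _ => by
    rw [hn, ← TensorProduct.smul_tmul, zsmul_eq_mul, mul_one]

/-- A continuous homomorphism from `ℂ` to the dual torus is the exponential of an `ℝ`-linear map. -/
theorem exists_expDual_of_continuous_hom (f : ℂ → DualTorus X) (hf : Continuous f)
    (hadd : ∀ v w, f (v + w) = f v * f w) :
    ∃ l l' : ℂ ⊗[ℤ] X, ∀ w, f w = expDual (w • l + conj w • l') := by
  classical
  let b := Module.Free.chooseBasis ℤ X
  choose α β h using fun i => exists_expU_of_continuous_hom (fun w => f w (dualCochar b i))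
    ((CharGrp.continuous_apply _).comp hf) (fun v w => by rw [hadd, CharGrp.mul_apply])
  refine ⟨∑ j, α j ⊗ₜ[ℤ] b j, ∑ j, β j ⊗ₜ[ℤ] b j, fun w => dualTorus_ext b fun i => ?_⟩
  rw [h i w, expDual_apply, map_add, pairing_smul, pairing_smul, pairing_sum_tmul,
    pairing_sum_tmul, mul_comm w, mul_comm (conj w)]

theorem eq_of_expDual_eq {l l' m m' : ℂ ⊗[ℤ] X}
    (h : ∀ w : ℂ, expDual (w • l + conj w • l') = expDual (w • m + conj w • m')) :
    l = m ∧ l' = m' := by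
  have h1 : ∀ ξ : Cochar X, pairing (castC ξ) (l - m) = 0 ∧ pairing (castC ξ) (l' - m') = 0 :=
    fun ξ => eq_zero_of_expU_eq_one fun w => by
      have h2 := DFunLike.congr_fun (h w) ξ
      rw [← div_eq_one, expDual_apply, expDual_apply, ← expU_sub, ← map_sub] at h2
      rw [← h2, mul_comm _ w, mul_comm _ (conj w), ← pairing_smul, ← pairing_smul, ← map_add]
      congr 2
      rw [smul_sub, smul_sub]
      abel
  exact ⟨eq_of_pairing_castC fun ξ => sub_eq_zero.mp (by rw [← map_sub, (h1 ξ).1]),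
    eq_of_pairing_castC fun ξ => sub_eq_zero.mp (by rw [← map_sub, (h1 ξ).2])⟩

end Pairing

section Action

variable {X : Type*} [AddCommGroup X] [DistribMulAction Gam X]

theorem actC_tmul (g : Gam) (c : ℂ) (x : X) : actC g (c ⊗ₜ[ℤ] x) = c ⊗ₜ[ℤ] (g • x) := rfl

theorem actC_smul (g : Gam) (c : ℂ) (v : ℂ ⊗[ℤ] X) : actC g (c • v) = c • actC g v := by
  induction v with
  | zero => simp
  | tmul d x => rw [TensorProduct.smul_tmul', actC_tmul, actC_tmul, TensorProduct.smul_tmul']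
  | add v w hv hw => rw [smul_add, map_add, map_add, hv, hw, smul_add]

theorem cc_smul_cc_smul (x : X) : cc • cc • x = x := by rw [← mul_smul, cc_mul_cc, one_smul]

theorem actC_cc_actC_cc (v : ℂ ⊗[ℤ] X) : actC cc (actC cc v) = v := by
  induction v with
  | zero => simp
  | tmul d x => rw [actC_tmul, actC_tmul, cc_smul_cc_smul]
  | add v w hv hw => rw [map_add, map_add, hv, hw]

theorem coact_cc_apply (ξ : Cochar X) (x : X) : coact cc ξ x = ξ (cc • x) := by
  rw [coact_apply, cc_inv]

theorem pairing_actC {H H' : X →+ ℂ} {c : ℂ} (h : ∀ x, H (cc • x) = c * H' x) (v : ℂ ⊗[ℤ] X) :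
    pairing H (actC cc v) = c * pairing H' v := by
  induction v with
  | zero => simp
  | tmul d x => rw [actC_tmul, pairing_tmul, pairing_tmul, h]; ring
  | add v w hv hw => rw [map_add, map_add, map_add, hv, hw, mul_add]

theorem pairing_castC_actC (ξ : Cochar X) (v : ℂ ⊗[ℤ] X) :
    pairing (castC ξ) (actC cc v) = pairing (castC (coact cc ξ)) v := by
  rw [pairing_actC (c := 1) (H' := castC (coact cc ξ)), one_mul]
  intro x
  rw [castC_apply, castC_apply, coact_cc_apply, one_mul]

theorem cc_smul_expDual (v : ℂ ⊗[ℤ] X) : cc • expDual v = expDual (actC cc v) :=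
  CharGrp.ext_apply fun ξ => by
    rw [smul_dual_apply, expDual_apply, expDual_apply, pairing_castC_actC, cc_inv]

theorem IsSymmetric.actC_half {a : X} (ha : IsSymmetric a) : actC cc (half a) = -half a := by
  rw [half, actC_tmul, ha.cc_smul, TensorProduct.tmul_neg]

end Action

/-! ### Characters of the group of real points -/

section LogAbs

variable {X : Type*} [AddCommGroup X]

/-- The homomorphism `x ↦ log |s(x)|`. -/
def logAbs (s : CPoints X) : X →+ ℂ where
  toFun x := (Real.log ‖(s x : ℂ)‖ : ℂ)
  map_zero' := by simp [CharGrp.map_zero]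
  map_add' x y := by
    rw [CharGrp.map_add, Units.val_mul, norm_mul, Real.log_mul (by simp) (by simp),
      Complex.ofReal_add]

theorem logAbs_apply (s : CPoints X) (x : X) : logAbs s x = (Real.log ‖(s x : ℂ)‖ : ℂ) := rfl

theorem logAbs_mul (s s' : CPoints X) : logAbs (s * s') = logAbs s + logAbs s' := by
  ext x
  rw [AddMonoidHom.add_apply, logAbs_apply, logAbs_apply, logAbs_apply, CharGrp.mul_apply,
    Units.val_mul, norm_mul, Real.log_mul (by simp) (by simp), Complex.ofReal_add]

theorem logAbs_eq_zero {s : CPoints X} (h : ∀ x, ‖(s x : ℂ)‖ = 1) : logAbs s = 0 := by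
  ext x
  rw [logAbs_apply, h, Real.log_one]
  rfl

theorem logAbs_expS (H : X →+ ℂ) (x : X) : logAbs (expS H) x = ((H x).re : ℂ) := by
  rw [logAbs_apply]
  change (Real.log ‖Complex.exp (H x)‖ : ℂ) = _
  rw [Complex.norm_exp, Real.log_exp]

theorem expS_apply (H : X →+ ℂ) (x : X) : expS H x = expU (H x) := rfl

theorem cocharPt_apply (ξ : Cochar X) (z : ℂˣ) (x : X) : cocharPt ξ z x = z ^ ξ x := rfl

theorem cocharPt_add (ξ η : Cochar X) (z : ℂˣ) :
    cocharPt (ξ + η) z = cocharPt ξ z * cocharPt η z :=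
  CharGrp.ext_apply fun x => zpow_add z (ξ x) (η x)

theorem cocharPt_zero (z : ℂˣ) : cocharPt (0 : Cochar X) z = 1 :=
  CharGrp.ext_apply fun _ => zpow_zero z

theorem cocharPt_mul (ξ : Cochar X) (z w : ℂˣ) :
    cocharPt ξ (z * w) = cocharPt ξ z * cocharPt ξ w :=
  CharGrp.ext_apply fun x => mul_zpow z w (ξ x)

theorem cocharPt_one (ξ : Cochar X) : cocharPt ξ 1 = 1 :=
  CharGrp.ext_apply fun x => one_zpow (ξ x)

theorem norm_cocharPt_neg_one (ξ : Cochar X) (x : X) : ‖(cocharPt ξ (-1) x : ℂ)‖ = 1 := by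
  rw [cocharPt_apply, Units.val_zpow_eq_zpow_val, norm_zpow]
  simp

/-- The character `s ↦ |s| ^ l * (s / |s|) ^ k` of `S(ℂ)`, for `l` in `X^*(S) ⊗ ℂ` and `k` in
`X^*(S)`. Every continuous character of `S(ℝ)` is the restriction of one of these. -/
def polarChar (l : ℂ ⊗[ℤ] X) (k : X) : CPoints X →* ℂˣ where
  toFun s := expU (pairing (logAbs s) (l - 1 ⊗ₜ k)) * s k
  map_one' := by
    rw [logAbs_eq_zero (by simp [CharGrp.one_apply]), pairing_zero, expU_zero, CharGrp.one_apply,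
      one_mul]
  map_mul' s s' := by
    rw [logAbs_mul, pairing_add, expU_add, CharGrp.mul_apply, mul_mul_mul_comm]

theorem polarChar_apply (l : ℂ ⊗[ℤ] X) (k : X) (s : CPoints X) :
    polarChar l k s = expU (pairing (logAbs s) (l - 1 ⊗ₜ k)) * s k := rfl

theorem polarChar_of_norm_eq_one (l : ℂ ⊗[ℤ] X) (k : X) {s : CPoints X}
    (h : ∀ x, ‖(s x : ℂ)‖ = 1) : polarChar l k s = s k := by
  rw [polarChar_apply, logAbs_eq_zero h, pairing_zero, expU_zero, one_mul]

theorem continuous_polarChar (l : ℂ ⊗[ℤ] X) (k : X) : Continuous (polarChar l k) := by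
  refine Continuous.mul (continuous_expU.comp ?_) (CharGrp.continuous_apply k)
  generalize l - 1 ⊗ₜ k = v
  induction v with
  | zero => simpa using continuous_const
  | tmul c x =>
    simp only [pairing_tmul, logAbs_apply]
    refine continuous_const.mul (Complex.continuous_ofReal.comp ?_)
    exact (Units.continuous_val.comp (CharGrp.continuous_apply x)).norm.log fun s => by simp
  | add v w hv hw =>
    simp only [map_add]
    exact hv.add hw

/-- At points with `|s(a)| = 1` a multiple of `a / 2` in the differential has no effect, and `N • a`
in the parameter of the compact part has the effect of the character `a ^ N`. -/
theorem polarChar_sub_smul_half (l : ℂ ⊗[ℤ] X) (k a : X) (c : ℂ) (N : ℤ) {s : CPoints X}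
    (h : ‖(s a : ℂ)‖ = 1) :
    polarChar (l - c • half a) (k - N • a) s * s a ^ N = polarChar l k s := by
  have h0 : logAbs s a = 0 := by rw [logAbs_apply, h, Real.log_one, Complex.ofReal_zero]
  rw [polarChar_apply, polarChar_apply, mul_assoc, ← CharGrp.map_zsmul, ← s.map_add,
    sub_add_cancel, map_sub, map_sub, map_sub, pairing_smul, pairing_half, pairing_one_tmul,
    pairing_one_tmul, map_sub, map_zsmul, h0]
  congr 2
  simp

end LogAbs

section RealPoints

variable {X : Type*} [AddCommGroup X] [DistribMulAction Gam X]

theorem RPoints.apply_cc {s : CPoints X} (hs : s ∈ RPoints X) (x : X) :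
    s (cc • x) = cc • s x := hs cc x

theorem norm_cc_smul (z : ℂˣ) : ‖((cc • z : ℂˣ) : ℂ)‖ = ‖(z : ℂ)‖ := Complex.norm_conj (z : ℂ)

theorem isRealLie_of_cc {H : X →+ ℂ} (h : ∀ x, H (cc • x) = conj (H x)) : IsRealLie H := by
  intro g x
  rcases gam_cases g with rfl | rfl
  · rw [one_smul]; rfl
  · exact h x

theorem IsRealLie.cc_smul {H : X →+ ℂ} (h : IsRealLie H) (x : X) : H (cc • x) = conj (H x) :=
  h cc x

theorem IsRealLie.expS_mem {H : X →+ ℂ} (h : IsRealLie H) : expS H ∈ RPoints X := fun g x => by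
  rw [expS_apply, expS_apply, h, smul_expU]

theorem logAbs_cc_smul {s : CPoints X} (hs : s ∈ RPoints X) (x : X) :
    logAbs s (cc • x) = logAbs s x := by
  rw [logAbs_apply, logAbs_apply, RPoints.apply_cc hs, norm_cc_smul]

theorem isRealLie_logAbs {s : CPoints X} (hs : s ∈ RPoints X) : IsRealLie (logAbs s) :=
  isRealLie_of_cc fun x => by rw [logAbs_cc_smul hs, logAbs_apply, Complex.conj_ofReal]

/-- Symmetric characters have absolute value one on `S(ℝ)`. -/
theorem IsSymmetric.norm_apply {a : X} (ha : IsSymmetric a) {s : CPoints X} (hs : s ∈ RPoints X) :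
    ‖(s a : ℂ)‖ = 1 := by
  have h := congrArg (fun z : ℂˣ => ‖(z : ℂ)‖) (RPoints.apply_cc hs a)
  simp only [norm_cc_smul] at h
  rw [ha.cc_smul, CharGrp.map_neg, Units.val_inv_eq_inv_val, norm_inv] at h
  have h0 : 0 < ‖(s a : ℂ)‖ := by simp
  have h1 := mul_inv_cancel₀ h0.ne'
  rw [h] at h1
  nlinarith

/-- The differential of a character of polar type on the Lie algebra of `S(ℝ)`. The element `h` is
`0` for characters of `S(ℝ)`, and `γ` for genuine characters of the Adams-Vogan cover. -/
theorem polarChar_expS {l m h : ℂ ⊗[ℤ] X} {k : X} (hh : actC cc h = -h)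
    (hk : h + 1 ⊗ₜ k = (1 / 2 : ℂ) • (l - actC cc l) - (m + actC cc m))
    {H : X →+ ℂ} (hH : IsRealLie H) :
    expU (pairing H h) * polarChar l k (expS H) = expU (pairing H l) := by
  -- `H` is the sum of its real part, which is invariant, and its imaginary part, which is
  -- anti-invariant.
  have h1 : ∀ v, pairing (logAbs (expS H)) (actC cc v) = pairing (logAbs (expS H)) v := fun v => by
    rw [pairing_actC (c := 1) (H' := logAbs (expS H)), one_mul]
    intro x
    rw [logAbs_cc_smul hH.expS_mem, one_mul]
  have h2 : ∀ v, pairing (H - logAbs (expS H)) (actC cc v) =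
      -pairing (H - logAbs (expS H)) v := fun v => by
    rw [pairing_actC (c := -1) (H' := H - logAbs (expS H)), neg_one_mul]
    intro x
    rw [AddMonoidHom.sub_apply, AddMonoidHom.sub_apply, logAbs_cc_smul hH.expS_mem, hH.cc_smul,
      logAbs_expS, Complex.ext_iff]
    simp
  have h3 : ∀ v, pairing H v = pairing (logAbs (expS H)) v + pairing (H - logAbs (expS H)) v :=
    fun v => by rw [← pairing_add, add_sub_cancel]
  have h4 := congrArg (pairing (H - logAbs (expS H))) hk
  rw [map_add, map_sub, pairing_smul, map_sub, map_add, h2, h2] at h4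
  have h5 : pairing (logAbs (expS H)) h = 0 := by
    have h6 := h1 h
    rw [hh, map_neg] at h6
    linear_combination (-1 / 2 : ℂ) * h6
  rw [polarChar_apply, expS_apply, ← expU_add, ← expU_add, ← pairing_one_tmul H k, h3 h, h3 l,
    h3 (1 ⊗ₜ k), map_sub, h5]
  congr 1
  linear_combination h4

/-- A genuine character of the Adams-Vogan cover has differential `l` and compact parameter `κ`
if and only if it is the product of the tautological genuine character `(s, z) ↦ z` and the
character `polarChar l (κ - γ)`. -/
theorem isAVCharacter_iff {a : X} (ha : IsSymmetric a) (θ : AVCover a →* ℂˣ) {l m : ℂ ⊗[ℤ] X}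
    {k : X} (hk : half a + 1 ⊗ₜ k = (1 / 2 : ℂ) • (l - actC cc l) - (m + actC cc m)) :
    IsAVCharacter a θ l k ↔ ∀ y : AVCover a, θ y = y.1.2 * polarChar l k y.1.1 := by
  constructor
  · rintro ⟨h1, h2⟩ y
    have hy : y.1.1 ∈ RPoints X := y.2.2
    have hH := isRealLie_logAbs hy
    -- Polar decomposition: `y` is `u = exp (log |s|)` times an element of the compact subgroup.
    obtain ⟨u, hu⟩ : ∃ u, u = expAV a (logAbs y.1.1) hH := ⟨_, rfl⟩
    have hu1 : u.1.1 = expS (logAbs y.1.1) := by rw [hu]; rfl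
    have hu2 : u.1.2 = 1 := by
      rw [hu]
      change expU (pairing (logAbs y.1.1) (half a)) = 1
      rw [pairing_half, logAbs_apply, ha.norm_apply hy, Real.log_one, Complex.ofReal_zero,
        zero_div, expU_zero]
    have hθu : θ u = u.1.2 * polarChar l k u.1.1 := by
      have h3 := polarChar_expS ha.actC_half hk hH
      rw [hu, h1, ← h3]
      rfl
    have h3 : ∀ x, ‖(((u⁻¹ * y).1.1 x : ℂˣ) : ℂ)‖ = 1 := fun x => by
      change ‖(((u.1.1 x)⁻¹ * y.1.1 x : ℂˣ) : ℂ)‖ = 1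
      rw [hu1, Units.val_mul, norm_mul, Units.val_inv_eq_inv_val, norm_inv, expS_apply, expU_coe,
        Complex.norm_exp, logAbs_apply, Complex.ofReal_re, Real.exp_log (by simp)]
      exact inv_mul_cancel₀ (by simp)
    have h4 := h2 _ h3
    rw [← polarChar_of_norm_eq_one l k h3] at h4
    have h5 : θ y = θ u * θ (u⁻¹ * y) := by rw [← map_mul, mul_inv_cancel_left]
    have h6 : y.1.1 = u.1.1 * (u⁻¹ * y).1.1 := (mul_inv_cancel_left u.1.1 y.1.1).symm
    have h7 : y.1.2 = u.1.2 * (u⁻¹ * y).1.2 := (mul_inv_cancel_left u.1.2 y.1.2).symm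
    rw [h5, hθu, h4, h6, h7, map_mul]
    exact mul_mul_mul_comm _ _ _ _
  · intro h
    refine ⟨fun H hH => ?_, fun y hy => ?_⟩
    · rw [h, ← polarChar_expS ha.actC_half hk hH]
      rfl
    · rw [h, polarChar_of_norm_eq_one l k hy]

end RealPoints

/-! ### The Weil group -/

theorem wz_one : wz 1 = 1 := rfl

theorem Tw.mul_left {G A : Type*} [Group G] [CommGroup A] [MulDistribMulAction G A]
    {t : Cocycle2 G A} (x y : Tw t) :
    (x * y).left = x.left * x.right • y.left * t.toFun x.right y.right := rfl

theorem Tw.one_left {G A : Type*} [Group G] [CommGroup A] [MulDistribMulAction G A]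
    {t : Cocycle2 G A} : (1 : Tw t).left = 1 := rfl

theorem Tw.mk_mul {G A : Type*} [Group G] [CommGroup A] [MulDistribMulAction G A]
    {t : Cocycle2 G A} (x : A) (y : Tw t) : (⟨x, 1⟩ : Tw t) * y = ⟨x * y.left, y.right⟩ := by
  refine Tw.ext ?_ (one_mul _)
  rw [Tw.mul_left, one_smul, t.one_left, mul_one]

theorem Tw.mul_mk {G A : Type*} [Group G] [CommGroup A] [MulDistribMulAction G A]
    {t : Cocycle2 G A} (x : A) (y : Tw t) :
    y * (⟨x, 1⟩ : Tw t) = ⟨y.right • x * y.left, y.right⟩ := by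
  refine Tw.ext ?_ (mul_one _)
  rw [Tw.mul_left, t.one_right, mul_one, mul_comm]

theorem Tw.mk_inv {G A : Type*} [Group G] [CommGroup A] [MulDistribMulAction G A]
    {t : Cocycle2 G A} (x : A) : (⟨x, 1⟩ : Tw t)⁻¹ = ⟨x⁻¹, 1⟩ := by
  rw [inv_eq_iff_mul_eq_one, Tw.mk_mul, mul_inv_cancel]
  rfl

theorem cyclicCocycle_cc_cc {A : Type*} [CommGroup A] [MulDistribMulAction Gam A] (y : A)
    (hy : ∀ g : Gam, g • y = y) : (cyclicCocycle y hy).toFun cc cc = y :=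
  if_pos ⟨rfl, rfl⟩

theorem wz_mul (z z' : ℂˣ) : wz (z * z') = wz z * wz z' := (Tw.mk_mul z (wz z')).symm

theorem wz_mul_wj (z : ℂˣ) : wz z * wj = ⟨z, cc⟩ := by
  rw [wz, Tw.mk_mul, wj, mul_one]

theorem wj_mul_wj : wj * wj = wz (-1) := by
  refine Tw.ext ?_ cc_mul_cc
  rw [Tw.mul_left]
  change 1 * cc • (1 : ℂˣ) * (cyclicCocycle (-1 : ℂˣ) _).toFun cc cc = -1
  rw [cyclicCocycle_cc_cc, smul_one, one_mul, one_mul]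

/-- Conjugation by an element of the Weil group acts on `ℂˣ` through the Galois group. -/
theorem mul_wz (w : Weil) (z : ℂˣ) : w * wz z = wz (w.right • z) * w := by
  rw [wz, Tw.mul_mk, wz, Tw.mk_mul]

theorem weil_cases (w : Weil) : ∃ z, w = wz z ∨ w = wz z * wj := by
  rcases w with ⟨z, g⟩
  rcases gam_cases g with rfl | rfl
  · exact ⟨z, Or.inl rfl⟩
  · exact ⟨z, Or.inr (wz_mul_wj z).symm⟩

theorem CosetReps.part_wz_mul (V : CosetReps) (z : ℂˣ) (u : Weil) :
    V.part 0 (wz z * u) = z * V.part 0 u := by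
  have h : V.v 0 * (wz z * u) = wz z * (V.v 0 * u) := by
    rw [← mul_assoc, mul_wz, V.right_zero, one_smul, mul_assoc]
  have h' : (wz z * u).right = u.right := one_mul _
  rw [CosetReps.part, CosetReps.part, h, h', mul_assoc, wz, Tw.mk_mul]

theorem CosetReps.part_one (V : CosetReps) : V.part 0 1 = 1 := by
  rw [CosetReps.part, if_pos (by rfl), mul_one, mul_inv_cancel]
  rfl

theorem stdReps_part_zero_wz (z : ℂˣ) : stdReps.part 0 (wz z) = z := by
  rw [← mul_one (wz z), CosetReps.part_wz_mul, CosetReps.part_one, mul_one]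

theorem stdReps_part_zero_wz_mul_wj (z : ℂˣ) : stdReps.part 0 (wz z * wj) = z := by
  rw [CosetReps.part_wz_mul, CosetReps.part, if_neg (by exact cc_ne_one)]
  change z * (1 * wj * wj⁻¹ : Weil).left = z
  rw [one_mul, mul_inv_cancel]
  exact mul_one z

theorem stdReps_part_one_wz (z : ℂˣ) : stdReps.part 1 (wz z) = cc • z := by
  rw [CosetReps.part, if_pos (by rfl)]
  change (wj * wz z * wj⁻¹ : Weil).left = cc • z
  rw [mul_wz, mul_inv_cancel_right]
  rfl

theorem stdReps_part_one_wz_mul_wj (z : ℂˣ) : stdReps.part 1 (wz z * wj) = cc • z * -1 := by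
  rw [CosetReps.part, if_neg (by rw [wz_mul_wj]; exact cc_ne_one)]
  change (wj * (wz z * wj) * 1⁻¹ : Weil).left = cc • z * -1
  rw [inv_one, mul_one, ← mul_assoc, mul_wz, mul_assoc, wj_mul_wj, ← wz_mul]
  rfl

/-! ### The Langlands correspondence for tori in terms of differentials -/

section LLC

variable {X : Type*} [AddCommGroup X] [DistribMulAction Gam X]

/-- The contribution of a single element of the Weil group to the transfer. -/
def transferTerm (w : Weil) (ξ : Cochar X) : CPoints X :=
  ∏ i : Fin 2, cocharPt (coact (stdReps.v i).right ξ) (stdReps.part i w)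

theorem transfer_eq (c : Weil →₀ Cochar X) : transfer c = c.prod transferTerm := rfl

theorem transferTerm_add (w : Weil) (ξ η : Cochar X) :
    transferTerm w (ξ + η) = transferTerm w ξ * transferTerm w η := by
  rw [transferTerm, transferTerm, transferTerm, ← Finset.prod_mul_distrib]
  exact Finset.prod_congr rfl fun i _ => by rw [coact_add, cocharPt_add]

theorem transferTerm_zero (w : Weil) : transferTerm w (0 : Cochar X) = 1 :=
  Finset.prod_eq_one fun i _ => by rw [coact_zero, cocharPt_zero]

theorem transferTerm_eq (w : Weil) (ξ : Cochar X) :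
    transferTerm w ξ =
      cocharPt ξ (stdReps.part 0 w) * cocharPt (coact cc ξ) (stdReps.part 1 w) := by
  rw [transferTerm, Fin.prod_univ_two]
  change cocharPt (coact 1 ξ) _ * _ = _
  rw [coact_one]
  rfl

/-- The element `u ⊗ ξ + conj u ⊗ σ ξ` of the Lie algebra of `S(ℝ)`. -/
def traceLie (u : ℂ) (ξ : Cochar X) : X →+ ℂ where
  toFun x := u * ξ x + conj u * ξ (cc • x)
  map_zero' := by simp
  map_add' x y := by simp; ring

theorem traceLie_apply (u : ℂ) (ξ : Cochar X) (x : X) :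
    traceLie u ξ x = u * ξ x + conj u * ξ (cc • x) := rfl

theorem isRealLie_traceLie (u : ℂ) (ξ : Cochar X) : IsRealLie (traceLie u ξ) :=
  isRealLie_of_cc fun x => by
    rw [traceLie_apply, traceLie_apply, cc_smul_cc_smul, _root_.map_add, map_mul, map_mul,
      Complex.conj_conj]
    simp only [map_intCast]
    ring

theorem pairing_traceLie (u : ℂ) (ξ : Cochar X) (v : ℂ ⊗[ℤ] X) :
    pairing (traceLie u ξ) v = pairing (castC ξ) (u • v + conj u • actC cc v) := by
  induction v with
  | zero => simp
  | tmul c x =>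
    rw [actC_tmul, TensorProduct.smul_tmul', TensorProduct.smul_tmul', map_add, pairing_tmul,
      pairing_tmul, pairing_tmul, traceLie_apply, castC_apply, castC_apply, smul_eq_mul,
      smul_eq_mul]
    ring
  | add v w hv hw =>
    rw [map_add, hv, hw, ← map_add, map_add (actC cc), smul_add, smul_add]
    congr 1
    abel

theorem transferTerm_wz (u : ℂ) (ξ : Cochar X) :
    transferTerm (wz (expU u)) ξ = expS (traceLie u ξ) := by
  rw [transferTerm_eq, stdReps_part_zero_wz, stdReps_part_one_wz, smul_expU]
  refine CharGrp.ext_apply fun x => ?_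
  rw [CharGrp.mul_apply, cocharPt_apply, cocharPt_apply, coact_cc_apply, ← expU_int_mul,
    ← expU_int_mul, ← expU_add, expS_apply, traceLie_apply]
  congr 1
  change _ + _ * conj u = _
  ring

theorem transferTerm_wz_one (ξ : Cochar X) : transferTerm (wz 1) ξ = 1 := by
  rw [transferTerm_eq, stdReps_part_zero_wz, stdReps_part_one_wz, smul_one, cocharPt_one,
    cocharPt_one, one_mul]

theorem transferTerm_wz_mul_wj (z : ℂˣ) (ξ : Cochar X) :
    transferTerm (wz z * wj) ξ = transferTerm (wz z) ξ * cocharPt (coact cc ξ) (-1) := by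
  rw [transferTerm_eq, transferTerm_eq, stdReps_part_zero_wz_mul_wj, stdReps_part_one_wz_mul_wj,
    stdReps_part_zero_wz, stdReps_part_one_wz, cocharPt_mul, mul_assoc]

theorem transfer_zero : transfer (0 : Weil →₀ Cochar X) = 1 := Finsupp.prod_zero_index

theorem transfer_add (c c' : Weil →₀ Cochar X) : transfer (c + c') = transfer c * transfer c' :=
  Finsupp.prod_add_index' transferTerm_zero transferTerm_add

theorem transfer_single (w : Weil) (ξ : Cochar X) :
    transfer (Finsupp.single w ξ) = transferTerm w ξ :=
  Finsupp.prod_single_index (transferTerm_zero w)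

theorem isCycle1_zero : IsCycle1 (0 : Weil →₀ Cochar X) := Finsupp.sum_zero_index

theorem IsCycle1.add {c c' : Weil →₀ Cochar X} (h : IsCycle1 c) (h' : IsCycle1 c') :
    IsCycle1 (c + c') := by
  rw [IsCycle1, Finsupp.sum_add_index', h, h', add_zero]
  · intro w; rw [coact_zero, sub_zero]
  · intro w ξ η; rw [coact_add]; abel

theorem isCycle1_single {w : Weil} {ξ : Cochar X} (h : coact w.right⁻¹ ξ = ξ) :
    IsCycle1 (Finsupp.single w ξ) := by
  rw [IsCycle1, Finsupp.sum_single_index, h, sub_self]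
  rw [coact_zero, sub_zero]

/-- The value of `polarChar l k` at the transfer of a cycle is the pairing of the cycle with the
cocycle of differential `l` whose value at `j` is `exp (2πi m)`. Term by term the two sides differ
by `exp (2πi ⟨ξ, σk / 2 - m⟩)` on `ℂˣ j`; the cycle condition says that the sum of the `ξ` attached
to elements of `ℂˣ j` is invariant, and on invariant cocharacters this factor is `1`. -/
theorem polarChar_transfer {t : Weil → DualTorus X} {l m : ℂ ⊗[ℤ] X} {k : X}
    (ht : ∀ w w' : Weil, t (w * w') = t w * w.right • t w')
    (htz : ∀ w : ℂ, t (wz (expU w)) = expDual (w • l + conj w • actC cc l))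
    (htj : t wj = expDual ((2 * Real.pi * Complex.I : ℂ) • m))
    (hk : (1 : ℂ) ⊗ₜ k = (1 / 2 : ℂ) • (l - actC cc l) - (m + actC cc m))
    {c : Weil →₀ Cochar X} (hc : IsCycle1 c) :
    polarChar l k (transfer c) = c.prod fun w ξ => t w ξ := by
  classical
  obtain ⟨D, hD⟩ : ∃ D : DualTorus X, D =
      zpowDual (-1) (cc • k) / expDual ((2 * Real.pi * Complex.I : ℂ) • m) := ⟨_, rfl⟩
  have hz : ∀ z ξ, polarChar l k (transferTerm (wz z) ξ) = t (wz z) ξ := fun z ξ => by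
    obtain ⟨u, rfl⟩ := exists_expU_eq z
    have h1 := polarChar_expS (h := 0) (by rw [map_zero, neg_zero]) (by rw [zero_add, hk])
      (isRealLie_traceLie u ξ)
    rw [map_zero, expU_zero, one_mul] at h1
    rw [transferTerm_wz, h1, htz, expDual_apply, pairing_traceLie]
  have hterm : ∀ w ξ, polarChar l k (transferTerm w ξ) =
      t w ξ * D (if w.right = 1 then 0 else ξ) := fun w ξ => by
    obtain ⟨z, rfl | rfl⟩ := weil_cases w
    · rw [if_pos (by rfl), D.map_zero, mul_one, hz]
    · have h1 : wz z * wj = (⟨z, cc⟩ : Weil) := wz_mul_wj z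
      have h2 : (cocharPt (coact cc ξ) (-1) k : ℂˣ) = zpowDual (-1) (cc • k) ξ := by
        rw [cocharPt_apply, coact_cc_apply]
        rfl
      have h3 : (wz z).right • t wj = t wj := one_smul _ _
      rw [if_neg (by rw [h1]; exact cc_ne_one), transferTerm_wz_mul_wj, map_mul, hz,
        polarChar_of_norm_eq_one _ _ (norm_cocharPt_neg_one _), ht, h3, CharGrp.mul_apply,
        mul_assoc, hD, CharGrp.div_apply, htj, h2, mul_div_cancel]
  have hDinv : ∀ η : Cochar X, coact cc η = η → D η = 1 := fun η hη => by
    have h1 : ∀ v, pairing (castC η) (actC cc v) = pairing (castC η) v := fun v => by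
      rw [pairing_castC_actC, hη]
    have h2 := congrArg (pairing (castC η)) hk
    rw [map_sub, pairing_smul, map_sub, map_add, h1, h1, pairing_one_tmul, castC_apply] at h2
    have h3 : η (cc • k) = η k := by rw [← coact_cc_apply, hη]
    rw [hD, CharGrp.div_apply, expDual_apply, pairing_smul, div_eq_one]
    change (-1 : ℂˣ) ^ η (cc • k) = _
    rw [h3, ← expU_pi_mul_I, ← expU_int_mul, expU_eq_expU_iff]
    exact ⟨η k, by linear_combination (-Real.pi * Complex.I : ℂ) * h2⟩
  have hsum : (c.sum fun w ξ => coact w.right⁻¹ ξ - ξ) =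
      coact cc (c.sum fun w ξ => if w.right = 1 then 0 else ξ) -
        c.sum fun w ξ => if w.right = 1 then 0 else ξ := by
    let F : Cochar X →+ Cochar X := ⟨⟨coact cc, coact_zero cc⟩, coact_add cc⟩
    change _ = F _ - _
    rw [Finsupp.sum, Finsupp.sum, map_sum, ← Finset.sum_sub_distrib]
    refine Finset.sum_congr rfl fun w _ => ?_
    change _ = coact cc _ - _
    rcases gam_cases w.right with h | h
    · rw [h, if_pos rfl, inv_one, coact_one, coact_zero, sub_self, sub_self]
    · rw [h, if_neg cc_ne_one, cc_inv]
  rw [IsCycle1, hsum, sub_eq_zero] at hc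
  have h1 := hDinv _ hc
  rw [Finsupp.sum, D.map_sum] at h1
  rw [transfer_eq, Finsupp.prod, map_prod, Finsupp.prod,
    ← mul_one (∏ w ∈ c.support, t w (c w)), ← h1, ← Finset.prod_mul_distrib]
  exact Finset.prod_congr rfl fun w _ => hterm w _

variable [Module.Free ℤ X] [Module.Finite ℤ X]

/-- The exponential of the Lie algebra of `S(ℝ)` consists of transfers of cycles on `ℂˣ`. -/
theorem IsRealLie.exists_transfer_eq {H : X →+ ℂ} (hH : IsRealLie H) :
    ∃ c : Weil →₀ Cochar X, IsCycle1 c ∧ transfer c = expS H := by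
  let b := Module.Free.chooseBasis ℤ X
  have h1 : expS H = ∏ i, expS (traceLie (H (b i) / 2) (dualCochar b i)) := by
    refine CharGrp.ext_apply fun x => ?_
    have h2 : ∀ s : Finset (Module.Free.ChooseBasisIndex ℤ X), ∀ f : _ → ℂ,
        expU (∑ i ∈ s, f i) = ∏ i ∈ s, expU (f i) := fun s f => by
      classical
      induction s using Finset.induction_on with
      | empty => exact expU_zero
      | insert i s hi ih => rw [Finset.sum_insert hi, Finset.prod_insert hi, expU_add, ih]
    rw [CharGrp.prod_apply, expS_apply]
    simp only [expS_apply]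
    rw [← h2]
    congr 1
    have h3 := sum_map_dualCochar b H x
    have h4 := congrArg conj (sum_map_dualCochar b H (cc • x))
    rw [hH.cc_smul, Complex.conj_conj, map_sum] at h4
    have h5 : ∀ i, traceLie (H (b i) / 2) (dualCochar b i) x =
        (H (b i) * (dualCochar b i x : ℂ)) / 2 +
          conj (H (b i) * (dualCochar b i (cc • x) : ℂ)) / 2 := fun i => by
      rw [traceLie_apply, map_div₀, map_mul, map_intCast, Complex.conj_ofNat]
      ring
    simp only [h5]
    rw [Finset.sum_add_distrib, ← Finset.sum_div, ← Finset.sum_div, h3, h4]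
    ring
  rw [h1]
  refine Finset.prod_induction _ (fun s => ∃ c : Weil →₀ Cochar X, IsCycle1 c ∧ transfer c = s)
    ?_ ⟨0, isCycle1_zero, transfer_zero⟩ ?_
  · rintro s s' ⟨c, hc, rfl⟩ ⟨c', hc', rfl⟩
    exact ⟨c + c', hc.add hc', transfer_add c c'⟩
  · intro i _
    refine ⟨Finsupp.single (wz (expU (H (b i) / 2))) (dualCochar b i), isCycle1_single ?_, ?_⟩
    · change coact 1⁻¹ _ = _
      rw [inv_one, coact_one]
    · rw [transfer_single, transferTerm_wz]

/-- Surjectivity of the transfer onto `S(ℝ)`. A point of `S(ℝ)` is the product of a point in the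
image of the exponential map and a point `η(-1)`, for an invariant cocharacter `η`; the latter is
the transfer of the cycle `η` supported at `j`. -/
theorem exists_transfer_eq {s : CPoints X} (hs : s ∈ RPoints X) :
    ∃ c : Weil →₀ Cochar X, IsCycle1 c ∧ transfer c = s := by
  let b := Module.Free.chooseBasis ℤ X
  choose α hα using fun i => exists_expU_eq (s (b i))
  let L : X →+ ℂ := (b.constr ℤ α).toAddMonoidHom
  -- `L` is a logarithm of `s` in the Lie algebra of `S(ℂ)`. The element `η` measures its failure to
  -- be real, and `H` is its real part.
  have hL : expS L = s := by
    refine CharGrp.ext_apply fun x => ?_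
    rw [← sum_dualCochar b x, CharGrp.map_sum, CharGrp.map_sum]
    refine Finset.prod_congr rfl fun i _ => ?_
    rw [CharGrp.map_zsmul, CharGrp.map_zsmul, expS_apply, ← hα]
    congr 2
    exact b.constr_basis ℤ α i
  have hLx : ∀ x, expU (L x) = s x := fun x => DFunLike.congr_fun hL x
  have hn : ∀ x, ∃ n : ℤ, L x = conj (L (cc • x)) + n * (2 * Real.pi * Complex.I) := fun x => by
    refine expU_eq_expU_iff.mp ?_
    have h1 := hs cc (cc • x)
    rw [cc_smul_cc_smul, ← hLx, ← hLx, smul_expU] at h1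
    exact h1
  choose n hn using hn
  have hpi : (2 * Real.pi * Complex.I : ℂ) ≠ 0 := Complex.two_pi_I_ne_zero
  have hinj : ∀ p q : ℤ, (p : ℂ) * (2 * Real.pi * Complex.I) = q * (2 * Real.pi * Complex.I) →
      p = q := fun p q h => Int.cast_injective (mul_right_cancel₀ hpi h)
  let η : Cochar X := AddMonoidHom.mk' n fun x y => hinj _ _ (by
    have h1 := hn (x + y)
    rw [smul_add, map_add, map_add, map_add] at h1
    push_cast
    linear_combination hn x + hn y - h1)
  have hη : coact cc η = η := by
    ext x
    rw [coact_cc_apply]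
    refine hinj _ _ ?_
    have h1 := congrArg conj (hn (cc • x))
    rw [cc_smul_cc_smul, map_add, Complex.conj_conj, map_mul, map_mul, map_mul, Complex.conj_I,
      Complex.conj_ofReal, Complex.conj_ofNat, map_intCast] at h1
    change (n (cc • x) : ℂ) * _ = n x * _
    linear_combination hn x + h1
  let H : X →+ ℂ :=
    { toFun := fun x => (L x + conj (L (cc • x))) / 2
      map_zero' := by simp
      map_add' := fun x y => by rw [smul_add, map_add, map_add, map_add]; ring }
  have hH : IsRealLie H := isRealLie_of_cc fun x => by
    change (L (cc • x) + conj (L (cc • cc • x))) / 2 = conj ((L x + conj (L (cc • x))) / 2)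
    rw [cc_smul_cc_smul, map_div₀, map_add, Complex.conj_conj, Complex.conj_ofNat, add_comm]
  obtain ⟨c, hc, hcH⟩ := hH.exists_transfer_eq
  refine ⟨c + Finsupp.single wj η, hc.add (isCycle1_single ?_), ?_⟩
  · change coact cc⁻¹ η = η
    rw [cc_inv, hη]
  · rw [transfer_add, transfer_single, hcH, ← one_mul wj, ← wz_one, transferTerm_wz_mul_wj,
      transferTerm_wz_one, one_mul, hη]
    refine CharGrp.ext_apply fun x => ?_
    rw [CharGrp.mul_apply, expS_apply, cocharPt_apply, ← hLx, ← expU_pi_mul_I, ← expU_int_mul,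
      ← expU_add]
    congr 1
    change (L x + conj (L (cc • x))) / 2 + n x * _ = L x
    linear_combination (-1 / 2 : ℂ) * hn x

/-- The Langlands correspondence for tori over `ℝ` in terms of differentials. -/
theorem isTorusParameter_iff {t : Weil → DualTorus X} {l m : ℂ ⊗[ℤ] X} {k : X}
    (ht : IsCocycle1 t)
    (htz : ∀ w : ℂ, t (wz (expU w)) = expDual (w • l + conj w • actC cc l))
    (htj : t wj = expDual ((2 * Real.pi * Complex.I : ℂ) • m))
    (hk : (1 : ℂ) ⊗ₜ k = (1 / 2 : ℂ) • (l - actC cc l) - (m + actC cc m))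
    (θ : RPoints X →* ℂˣ) :
    IsTorusParameter θ t ↔ ∀ s : RPoints X, θ s = polarChar l k (s : CPoints X) := by
  constructor
  · rintro ⟨-, h⟩ s
    obtain ⟨c, hc, hcs⟩ := exists_transfer_eq s.2
    rw [h c hc s hcs.symm, ← hcs, polarChar_transfer ht.2 htz htj hk hc]
  · refine fun h => ⟨ht, fun c hc s hs => ?_⟩
    rw [h, hs, polarChar_transfer ht.2 htz htj hk hc]

end LLC

/-! ### Differentials of Langlands parameters -/

section Parameters

theorem Tw.continuous_left {G A : Type*} [Group G] [CommGroup A] [MulDistribMulAction G A]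
    [TopologicalSpace A] [TopologicalSpace G] {t : Cocycle2 G A} :
    Continuous fun x : Tw t => x.left := by
  have h : Continuous fun x : Tw t => (x.left, x.right) := continuous_induced_dom
  exact h.fst

theorem Tw.continuous_right {G A : Type*} [Group G] [CommGroup A] [MulDistribMulAction G A]
    [TopologicalSpace A] [TopologicalSpace G] {t : Cocycle2 G A} :
    Continuous fun x : Tw t => x.right := by
  have h : Continuous fun x : Tw t => (x.left, x.right) := continuous_induced_dom
  exact h.snd

theorem continuous_wz : Continuous wz :=
  continuous_induced_rng.mpr (continuous_id.prodMk continuous_const)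

variable {X : Type*} [AddCommGroup X] [DistribMulAction Gam X]

/-- Every Langlands parameter into the Adams-Vogan `L`-group has the form required in the
Adams-Vogan correspondence, and `½ (1 - σ) l - (1 + σ) m` lies in `γ + X^*(S)`. The last assertion
is the relation `j² = -1`. -/
theorem IsLParameter.exists_differential [Module.Free ℤ X] [Module.Finite ℤ X] {a : X}
    {ha : IsSymmetric a} {φ : Weil →* EGroup a ha} (hφ : IsLParameter φ) :
    ∃ (l m : ℂ ⊗[ℤ] X) (k : X),
      (∀ w : ℂ, φ (wz (expU w)) = ⟨expDual (w • l + conj w • actC cc l), 1⟩) ∧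
      φ wj = ⟨expDual ((2 * Real.pi * Complex.I : ℂ) • m), 1⟩ * delta a ha ∧
      half a + (1 : ℂ) ⊗ₜ[ℤ] k = (1 / 2 : ℂ) • (l - actC cc l) - (m + actC cc m) := by
  obtain ⟨hcont, hright⟩ := hφ
  have hφz : ∀ z, φ (wz z) = ⟨(φ (wz z)).left, 1⟩ := fun z => Tw.ext rfl (hright (wz z))
  have hφj : (φ wj).right = cc := hright wj
  obtain ⟨l, l', hl⟩ := exists_expDual_of_continuous_hom (fun w => (φ (wz (expU w))).left)
    (Tw.continuous_left.comp (hcont.comp (continuous_wz.comp continuous_expU)))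
    (fun v w => by
      rw [expU_add, wz_mul, map_mul, hφz (expU v), Tw.mk_mul])
  have hconj : ∀ z, cc • (φ (wz z)).left = (φ (wz (cc • z))).left := fun z => by
    have h1 := congrArg φ (mul_wz wj z)
    rw [map_mul, map_mul, hφz z, Tw.mul_mk, hφz (wj.right • z), Tw.mk_mul, hφj] at h1
    exact mul_right_cancel (congrArg Tw.left h1)
  have hl' : l' = actC cc l := by
    refine (eq_of_expDual_eq (l := l') (l' := l) (m := actC cc l) (m' := actC cc l')
      fun w => ?_).1
    have h1 := hconj (expU w)
    have h2 : cc • expU w = expU (conj w) := smul_expU cc w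
    have h3 := hl w
    have h4 := hl (conj w)
    rw [h2, h3, h4, cc_smul_expDual, map_add, actC_smul, actC_smul, Complex.conj_conj] at h1
    rw [h1, add_comm]
  subst hl'
  obtain ⟨v, hv⟩ := expDual_surjective (φ wj).left
  have hm : (2 * Real.pi * Complex.I : ℂ) • ((2 * Real.pi * Complex.I : ℂ)⁻¹ • v) = v :=
    smul_inv_smul₀ Complex.two_pi_I_ne_zero v
  obtain ⟨m, hmv⟩ : ∃ m : ℂ ⊗[ℤ] X, (2 * Real.pi * Complex.I : ℂ) • m = v := ⟨_, hm⟩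
  have hjj : expDual ((2 * Real.pi * Complex.I : ℂ) •
      ((1 / 2 : ℂ) • (l - actC cc l) - (m + actC cc m) - half a)) = 1 := by
    have h1 := congrArg (fun w => (φ w).left) wj_mul_wj
    have h2 := hl (Real.pi * Complex.I)
    simp only [map_mul, Tw.mul_left, hφj, ← expU_pi_mul_I] at h1 h2
    rw [h2, cyclicCocycle_cc_cc, ← hv, ← hmv, cc_smul_expDual, ← expDual_add, ← expDual_add,
      actC_smul, Complex.conj_ofReal, Complex.conj_I] at h1
    rw [← div_eq_one.mpr h1.symm, ← expDual_sub]
    congr 1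
    module
  obtain ⟨k, hk⟩ := exists_eq_one_tmul_of_expDual_eq_one hjj
  refine ⟨l, m, k, fun w => ?_, ?_, ?_⟩
  · rw [hφz, ← hl]
  · rw [Tw.mk_mul, hmv, hv]
    refine Tw.ext (mul_one _).symm hφj
  · rw [← hk, add_sub_cancel]

/-! ### The cochain attached to χ-data -/

variable {a : X} {ha : IsSymmetric a}

theorem mem_pmSet_iff {b : X} : b ∈ (pmSet a ha).carrier ↔ b = a ∨ b = -a := by
  simp [pmSet]

/-- The element `χ_b(z) ^ b` is independent of `b` in `{a, -a}`. -/
theorem ChiData.zpowDual_chi (D : ChiData (pmSet a ha)) {b : X} (hb : b ∈ (pmSet a ha).carrier)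
    (z : ℂˣ) : zpowDual (D.chi b z) b = zpowDual (D.chi a z) a := by
  rcases mem_pmSet_iff.mp hb with rfl | rfl
  · rfl
  · rw [D.neg a (mem_pmSet a ha), zpowDual_neg, inv_inv]

theorem cc_smul_zpowDual (ha : IsSymmetric a) (z : ℂˣ) : cc • zpowDual z a = (zpowDual z a)⁻¹ := by
  rw [zpowDual_smul, ha.cc_smul, zpowDual_neg, zpowDual_inv]

theorem ChiData.chi_cc_smul (D : ChiData (pmSet a ha)) (z : ℂˣ) :
    D.chi a (cc • z) = (D.chi a z)⁻¹ := by
  have h := D.smul cc a (mem_pmSet a ha) z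
  rw [ha.cc_smul, D.neg a (mem_pmSet a ha), cc_inv] at h
  exact h.symm

theorem ChiData.chi_neg_one (D : ChiData (pmSet a ha)) : D.chi a (-1) = -1 := by
  have h : (-1 : ℂˣ) = realUnit (-1) := Units.ext (by simp [realUnit])
  rw [h, D.real a (mem_pmSet a ha), kappa, if_neg (by simp), ← h]

section rp

variable {p : Gauge (pmSet a ha)} (D : ChiData (pmSet a ha)) (C : ParamChoice (pmSet a ha) p)

theorem rp_wz_mul (z : ℂˣ) (w : Weil) :
    rp D C (wz z * w) = zpowDual (D.chi a z) a * rp D C w := by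
  have h1 : C.w1 * (wz z * w) * C.w1⁻¹ = wz (C.w1.right • z) * (C.w1 * w * C.w1⁻¹) := by
    rw [← mul_assoc, mul_wz, mul_assoc, mul_assoc, mul_assoc]
  have h2 := D.smul C.w1.right⁻¹ C.b C.mem z
  rw [inv_inv] at h2
  rw [rp, rp, h1, CosetReps.part_wz_mul, map_mul, zpowDual_mul, ← h2,
    D.zpowDual_chi ((pmSet a ha).smul_mem _ _ C.mem)]

theorem rp_one : rp D C 1 = 1 := by
  rw [rp, mul_one, mul_inv_cancel, CosetReps.part_one, map_one, zpowDual_one]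

theorem rp_wz (z : ℂˣ) : rp D C (wz z) = zpowDual (D.chi a z) a := by
  rw [← mul_one (wz z), rp_wz_mul, rp_one, mul_one]

theorem exists_rp_wj : ∃ u, rp D C wj = zpowDual u a := by
  rcases mem_pmSet_iff.mp ((pmSet a ha).smul_mem C.w1.right⁻¹ _ C.mem) with h | h
  · exact ⟨_, by rw [rp, h]⟩
  · exact ⟨_, by rw [rp, h, zpowDual_neg]⟩

theorem continuous_rp : Continuous (rp D C) := by
  have h : rp D C = fun w => zpowDual (D.chi a w.left) a * rp D C ⟨1, w.right⟩ := by
    funext w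
    rw [← rp_wz_mul, wz, Tw.mk_mul, mul_one]
  rw [h]
  refine CharGrp.continuous_of_apply fun ξ => ?_
  have h1 : Continuous fun g : Gam => rp D C ⟨1, g⟩ ξ := continuous_of_discreteTopology
  exact ((CharGrp.continuous_apply ξ).comp ((continuous_zpowDual a).comp
    ((D.cont a (mem_pmSet a ha)).comp Tw.continuous_left))).mul (h1.comp Tw.continuous_right)

/-- The cochain `r_p` splits the pull-back to the Weil group of the Tits cocycle. -/
theorem rp_mul {t : Cocycle2 Gam (DualTorus X)} (ht : t.toFun cc cc = zpowDual (-1) a)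
    (w w' : Weil) :
    rp D C (w * w') = rp D C w * w.right • rp D C w' * t.toFun w.right w'.right := by
  obtain ⟨u, hu⟩ := exists_rp_wj D C
  have hz : ∀ z, (wz z).right = 1 := fun _ => rfl
  obtain ⟨z, rfl | rfl⟩ := weil_cases w
  · rw [rp_wz_mul, rp_wz, hz, one_smul, t.one_left, mul_one]
  · have hzj : ∀ z, (wz z * wj).right = cc := fun z => one_mul cc
    obtain ⟨z', rfl | rfl⟩ := weil_cases w'
    · rw [mul_assoc, mul_wz, rp_wz_mul, rp_wz_mul, rp_wz_mul, rp_wz, hzj, hz, t.one_right, mul_one,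
        cc_smul_zpowDual ha]
      change _ * (zpowDual (D.chi a (cc • z')) a * _) = _
      rw [D.chi_cc_smul, zpowDual_inv, mul_assoc, mul_comm _ (rp D C wj)]
    · rw [mul_assoc, ← mul_assoc wj, mul_wz, mul_assoc _ wj, wj_mul_wj, rp_wz_mul, rp_wz_mul,
        rp_wz, rp_wz_mul, rp_wz_mul, hzj, hzj, ht, smul_mul', hu, cc_smul_zpowDual ha,
        cc_smul_zpowDual ha, D.chi_neg_one]
      change _ * (zpowDual (D.chi a (cc • z')) a * _) = _
      rw [D.chi_cc_smul, zpowDual_inv]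
      rw [mul_assoc (zpowDual (D.chi a z) a), mul_left_comm (zpowDual u a), mul_inv_cancel,
        mul_one, mul_assoc]

theorem rp_wz_expU {N : ℤ}
    (hN : ∀ w, D.chi a (expU w) = expU ((2 * N + 1) * ((w - conj w) / 2))) (w : ℂ) :
    rp D C (wz (expU w)) = expDual (w • ((2 * N + 1 : ℂ) • half a) +
      conj w • actC cc ((2 * N + 1 : ℂ) • half a)) := by
  rw [rp_wz, hN, ← expDual_smul_half, actC_smul, ha.actC_half]
  congr 1
  module

theorem exists_rp_wj_eq_expDual :
    ∃ c : ℂ, rp D C wj = expDual ((2 * Real.pi * Complex.I : ℂ) • (c • half a)) := by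
  obtain ⟨u, hu⟩ := exists_rp_wj D C
  obtain ⟨v, rfl⟩ := exists_expU_eq u
  refine ⟨(2 * Real.pi * Complex.I)⁻¹ * (2 * v), ?_⟩
  rw [smul_smul, mul_inv_cancel_left₀ Complex.two_pi_I_ne_zero, expDual_smul_half, hu]

end rp

end Parameters

/-! ### The isomorphism of the two double covers -/

section Covers

/-- The homomorphism `z ↦ z / |z|` on `ℂˣ`. -/
def unitPart : ℂˣ →* ℂˣ where
  toFun z := Units.mk0 ((z : ℂ) / (‖(z : ℂ)‖ : ℂ)) (div_ne_zero z.ne_zero (by simp))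
  map_one' := Units.ext (by simp)
  map_mul' z w := Units.ext (by simp [mul_div_mul_comm])

theorem unitPart_coe (z : ℂˣ) : (unitPart z : ℂ) = (z : ℂ) / (‖(z : ℂ)‖ : ℂ) := rfl

theorem continuous_unitPart : Continuous unitPart := by
  refine Units.isEmbedding_val₀.continuous_iff.mpr ?_
  change Continuous fun z : ℂˣ => (z : ℂ) / (‖(z : ℂ)‖ : ℂ)
  exact Units.continuous_val.div (Complex.continuous_ofReal.comp Units.continuous_val.norm)
    (by simp)

theorem unitPart_of_norm_eq_one {z : ℂˣ} (h : ‖(z : ℂ)‖ = 1) : unitPart z = z :=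
  Units.ext (by rw [unitPart_coe, h, Complex.ofReal_one, div_one])

theorem unitPart_sq (z : ℂˣ) : unitPart z ^ 2 = z / cc • z := by
  apply Units.ext
  rw [Units.val_pow_eq_pow_val, unitPart_coe, Units.val_div_eq_div_val]
  change _ = (z : ℂ) / conj (z : ℂ)
  have h : (‖(z : ℂ)‖ : ℂ) ^ 2 = z * conj (z : ℂ) := (Complex.mul_conj' _).symm
  have h0 : (z : ℂ) ≠ 0 := z.ne_zero
  rw [div_pow, h, sq, mul_div_mul_left _ _ h0]

theorem realUnit_mem_normGroup {r : ℝˣ} (hr : 0 < (r : ℝ)) : realUnit r ∈ normGroup := by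
  refine ⟨realUnit (Units.mk0 (Real.sqrt r) (Real.sqrt_pos.mpr hr).ne'), Units.ext ?_⟩
  change ((r : ℝ) : ℂ) = (Real.sqrt r : ℂ) * conj (Real.sqrt r : ℂ)
  rw [Complex.conj_ofReal, ← Complex.ofReal_mul, Real.mul_self_sqrt hr.le]

theorem normGroup_le_ker_unitPart : normGroup ≤ unitPart.ker := by
  rintro _ ⟨w, rfl⟩
  rw [MonoidHom.mem_ker]
  apply Units.ext
  rw [unitPart_coe]
  change ((w : ℂ) * conj (w : ℂ)) / (‖(w : ℂ) * conj (w : ℂ)‖ : ℂ) = 1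
  rw [norm_mul, Complex.norm_conj, Complex.mul_conj', Complex.ofReal_mul, sq]
  exact div_self (mul_ne_zero (by simp) (by simp))

theorem mk_unitPart (z : ℂˣ) : (QuotientGroup.mk (unitPart z) : ℂˣ ⧸ normGroup) = z := by
  rw [QuotientGroup.eq]
  have h : (unitPart z)⁻¹ * z = realUnit (Units.mk0 ‖(z : ℂ)‖ (by simp)) := by
    rw [inv_mul_eq_iff_eq_mul]
    apply Units.ext
    rw [Units.val_mul, unitPart_coe]
    exact (div_mul_cancel₀ _ (by simp)).symm
  rw [h]
  exact realUnit_mem_normGroup (by simp)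

theorem angle_mk (z : ℂˣ) : angle (QuotientGroup.mk z) = z / cc • z := rfl

/-- The map `z ↦ z / |z|` on `ℂˣ` modulo norms. -/
def unitPartQuot : ℂˣ ⧸ normGroup →* ℂˣ :=
  QuotientGroup.lift normGroup unitPart normGroup_le_ker_unitPart

theorem unitPartQuot_mk (z : ℂˣ) : unitPartQuot (QuotientGroup.mk z) = unitPart z := rfl

theorem continuous_unitPartQuot : Continuous unitPartQuot :=
  (QuotientGroup.isQuotientMap_mk normGroup).continuous_iff.mpr continuous_unitPart

variable {X : Type*} [AddCommGroup X] [DistribMulAction Gam X] {a : X}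

theorem AVCover.sq_eq (y : AVCover a) : y.1.1 a = y.1.2 ^ 2 := y.2.1

theorem AVCover.mem_RPoints (y : AVCover a) : y.1.1 ∈ RPoints X := y.2.2

theorem AVCover.norm_eq_one (ha : IsSymmetric a) (y : AVCover a) : ‖(y.1.2 : ℂ)‖ = 1 := by
  have h := ha.norm_apply (AVCover.mem_RPoints y)
  rw [AVCover.sq_eq y, Units.val_pow_eq_pow_val, norm_pow] at h
  exact (pow_eq_one_iff_of_nonneg (norm_nonneg _) two_ne_zero).mp h

theorem AVCover.angle_eq (ha : IsSymmetric a) (y : AVCover a) :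
    angle (QuotientGroup.mk y.1.2) = y.1.1 a := by
  rw [angle_mk, ← unitPart_sq, unitPart_of_norm_eq_one (AVCover.norm_eq_one ha y), AVCover.sq_eq]

theorem PMCover.apply_eq_sq (u : PMCover a) : u.1.1 a = unitPartQuot u.1.2 ^ 2 := by
  obtain ⟨z, hz⟩ := QuotientGroup.mk_surjective u.1.2
  rw [← u.2.2, ← hz, unitPartQuot_mk, unitPart_sq, angle_mk]

theorem mk_unitPartQuot (δ : ℂˣ ⧸ normGroup) : QuotientGroup.mk (unitPartQuot δ) = δ := by
  obtain ⟨z, rfl⟩ := QuotientGroup.mk_surjective δ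
  exact mk_unitPart z

/-- The isomorphism `(s, z) ↦ (s, [z])` from `S(ℝ)_γ` to `S(ℝ)_±`. Its inverse is
`(s, [δ]) ↦ (s, δ / |δ|)`. -/
def coverEquiv (ha : IsSymmetric a) : AVCover a ≃ₜ* PMCover a where
  toFun y := ⟨(y.1.1, QuotientGroup.mk y.1.2), AVCover.mem_RPoints y, AVCover.angle_eq ha y⟩
  invFun u := ⟨(u.1.1, unitPartQuot u.1.2), PMCover.apply_eq_sq u, u.2.1⟩
  left_inv y := Subtype.ext (Prod.ext rfl (unitPart_of_norm_eq_one (AVCover.norm_eq_one ha y)))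
  right_inv u := Subtype.ext (Prod.ext rfl (mk_unitPartQuot u.1.2))
  map_mul' _ _ := rfl
  continuous_toFun := ((continuous_fst.comp continuous_subtype_val).prodMk
    (QuotientGroup.continuous_mk.comp (continuous_snd.comp continuous_subtype_val))).subtype_mk _
  continuous_invFun := ((continuous_fst.comp continuous_subtype_val).prodMk
    (continuous_unitPartQuot.comp (continuous_snd.comp continuous_subtype_val))).subtype_mk _

theorem coverEquiv_apply (ha : IsSymmetric a) (y : AVCover a) :
    (coverEquiv ha y).1 = (y.1.1, QuotientGroup.mk y.1.2) := rfl

/-- In terms of the Adams-Vogan cover, `χ_S` is an odd power of the tautological genuine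
character. -/
theorem chiS_coverEquiv {ha : IsSymmetric a} (D : ChiData (pmSet a ha)) {N : ℤ}
    (hN : ∀ w, D.chi a (expU w) = expU ((2 * N + 1) * ((w - conj w) / 2))) (y : AVCover a) :
    chiS a ha D (coverEquiv ha y) = y.1.2 * y.1.1 a ^ N := by
  change D.chi a y.1.2 = _
  obtain ⟨w, hw⟩ := exists_expU_eq y.1.2
  have h := AVCover.norm_eq_one ha y
  rw [← hw, expU_coe, Complex.norm_exp, Real.exp_eq_one_iff] at h
  have hconj : conj w = -w := by rw [Complex.ext_iff]; simp [h]
  rw [AVCover.sq_eq y, ← hw, hN, hconj, sq, ← expU_add, ← expU_int_mul, ← expU_add]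
  congr 1
  ring

end Covers

/-! ### The isomorphism of the two `L`-groups -/

section LGroups

variable {X : Type*} [AddCommGroup X] [DistribMulAction Gam X] {a : X} {ha : IsSymmetric a}

theorem Gauge.neg_gen (p : Gauge (pmSet a ha)) : p.toFun (-a) = -p.toFun a :=
  p.neg a (mem_pmSet a ha)

theorem titsCocycle_cc_cc (p : Gauge (pmSet a ha)) :
    (titsCocycle (pmSet a ha) p).toFun cc cc = zpowDual (-1) a := by
  classical
  change zpowDual (-1) (∑ b ∈ titsSet (pmSet a ha) p cc cc, b) = _
  have hmem : ∀ b, b ∈ titsSet (pmSet a ha) p cc cc ↔ (b = a ∨ b = -a) ∧ p.toFun b = 1 := by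
    intro b
    rw [titsSet, Finset.mem_filter, mem_pmSet_iff, cc_mul_cc, inv_one, one_smul, cc_inv]
    refine and_congr_right fun hb => ⟨fun h => h.1, fun h => ⟨h, ?_, h⟩⟩
    have h1 : cc • b = -b := by
      rcases hb with rfl | rfl
      · exact ha.cc_smul
      · rw [smul_neg, ha.cc_smul]
    rw [h1, p.neg b (mem_pmSet_iff.mpr hb), h]
  rcases Int.units_eq_one_or (p.toFun a) with h | h
  · have h1 : titsSet (pmSet a ha) p cc cc = {a} := by
      ext b
      rw [hmem, Finset.mem_singleton]
      constructor
      · rintro ⟨rfl | rfl, hb⟩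
        · rfl
        · rw [p.neg_gen, h] at hb
          exact absurd hb (by decide)
      · rintro rfl
        exact ⟨Or.inl rfl, h⟩
    rw [h1, Finset.sum_singleton]
  · have h1 : titsSet (pmSet a ha) p cc cc = {-a} := by
      ext b
      rw [hmem, Finset.mem_singleton]
      constructor
      · rintro ⟨rfl | rfl, hb⟩
        · rw [h] at hb
          exact absurd hb (by decide)
        · rfl
      · rintro rfl
        exact ⟨Or.inr rfl, by rw [p.neg_gen, h, neg_neg]⟩
    rw [h1, Finset.sum_singleton, zpowDual_neg_one]

theorem cocycle2_eq_of_cc_cc {A : Type*} [CommGroup A] [MulDistribMulAction Gam A]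
    {t t' : Cocycle2 Gam A} (h : t.toFun cc cc = t'.toFun cc cc) (g g' : Gam) :
    t.toFun g g' = t'.toFun g g' := by
  rcases gam_cases g with rfl | rfl
  · rw [t.one_left, t'.one_left]
  · rcases gam_cases g' with rfl | rfl
    · rw [t.one_right, t'.one_right]
    · exact h

/-- Twisted products for equal cocycles are the same group. -/
def Tw.congr {G A : Type*} [Group G] [CommGroup A] [MulDistribMulAction G A]
    [TopologicalSpace A] [TopologicalSpace G] {t t' : Cocycle2 G A}
    (h : ∀ g g', t.toFun g g' = t'.toFun g g') : Tw t ≃ₜ* Tw t' where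
  toFun x := ⟨x.left, x.right⟩
  invFun x := ⟨x.left, x.right⟩
  left_inv _ := rfl
  right_inv _ := rfl
  map_mul' x y := Tw.ext (by rw [Tw.mul_left, Tw.mul_left, h]) rfl
  continuous_toFun := continuous_induced_rng.mpr
    (Tw.continuous_left.prodMk Tw.continuous_right)
  continuous_invFun := continuous_induced_rng.mpr
    (Tw.continuous_left.prodMk Tw.continuous_right)

theorem cyclicCocycle_eq_titsCocycle (p : Gauge (pmSet a ha)) (g g' : Gam) :
    (cyclicCocycle (expDual ((2 * Real.pi * Complex.I : ℂ) • half a))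
      (expDual_half_invariant ha)).toFun g g' = (titsCocycle (pmSet a ha) p).toFun g g' :=
  cocycle2_eq_of_cc_cc (by rw [cyclicCocycle_cc_cc, titsCocycle_cc_cc, expDual_half]) g g'

/-- The isomorphism from the Adams-Vogan `L`-group to the Galois form of the `L`-group. Both have
the underlying set `Ŝ × Γ`, and the two cocycles agree: the Tits cocycle takes the value
`(-1) ^ (2γ) = exp (2πiγ)` for every gauge. -/
def lGroupEquiv (p : Gauge (pmSet a ha)) : EGroup a ha ≃ₜ* LGroup (pmSet a ha) p :=
  Tw.congr (cyclicCocycle_eq_titsCocycle p)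

/-- Both index sets in the definition of `s_{p/q}` are empty, since each element of `Γ` acts on
`R` as `1` or as `-1`. -/
theorem gaugeCochain_eq_one (p q : Gauge (pmSet a ha)) (g : Gam) :
    gaugeCochain (pmSet a ha) p q g = 1 := by
  classical
  have hg : ∀ r : Gauge (pmSet a ha), ∀ b ∈ (pmSet a ha).carrier,
      (g = 1 → r.toFun (g⁻¹ • b) = r.toFun b) ∧ (g = cc → r.toFun (g⁻¹ • b) = -r.toFun b) := by
    intro r b hb
    refine ⟨?_, ?_⟩
    · rintro rfl
      rw [inv_one, one_smul]
    · rintro rfl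
      rw [← r.neg b hb, cc_inv]
      rcases mem_pmSet_iff.mp hb with rfl | rfl
      · rw [ha.cc_smul]
      · rw [smul_neg, ha.cc_smul]
  rw [gaugeCochain, Finset.filter_eq_empty_iff.mpr, Finset.filter_eq_empty_iff.mpr,
    Finset.sum_empty, add_zero, zpowDual_zero]
  · rintro b hb ⟨h1, h2, h3, h4⟩
    rcases gam_cases g with h | h
    · rw [(hg q b hb).1 h, h3] at h4
      exact absurd h4 (by decide)
    · rw [(hg p b hb).2 h, h1] at h2
      exact absurd h2 (by decide)
  · rintro b hb ⟨h1, h2, h3, h4⟩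
    rcases gam_cases g with h | h
    · rw [(hg p b hb).1 h, h1] at h2
      exact absurd h2 (by decide)
    · rw [(hg q b hb).2 h, h3] at h4
      exact absurd h4 (by decide)

end LGroups

/-! ### Comparison of the two correspondences -/

section Comparison

variable {X : Type*} [AddCommGroup X] [DistribMulAction Gam X] {a : X} {ha : IsSymmetric a}

/-- The passage from a genuine parameter to the torus parameter obtained by removing `χ_S`. Here
`m'` may differ from `m` by anti-invariant elements, such as the contributions of `r_p(j)` and of
a conjugation under the dual torus. -/
theorem one_tmul_sub_eq (ha : IsSymmetric a) {l m m' : ℂ ⊗[ℤ] X} {k : X} (N : ℤ)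
    (hk : half a + 1 ⊗ₜ k = (1 / 2 : ℂ) • (l - actC cc l) - (m + actC cc m))
    (hm : m' + actC cc m' = m + actC cc m) :
    (1 : ℂ) ⊗ₜ[ℤ] (k - N • a) =
      (1 / 2 : ℂ) • ((l - (2 * N + 1 : ℂ) • half a) - actC cc (l - (2 * N + 1 : ℂ) • half a)) -
        (m' + actC cc m') := by
  have h1 : (1 : ℂ) ⊗ₜ[ℤ] (N • a) = (2 * N : ℂ) • half a := by
    rw [half, TensorProduct.smul_tmul', ← TensorProduct.smul_tmul]
    congr 1
    rw [zsmul_eq_mul, smul_eq_mul]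
    ring
  have h2 : (1 : ℂ) ⊗ₜ[ℤ] k = (1 / 2 : ℂ) • (l - actC cc l) - (m + actC cc m) - half a := by
    rw [← hk, add_sub_cancel_left]
  rw [TensorProduct.tmul_sub, h1, h2, hm, map_sub, actC_smul, ha.actC_half]
  module

/-- The restriction of a character of `S(ℂ)` to `S(ℝ)`, multiplied by `χ_S`, on the Adams-Vogan
cover. -/
theorem polarChar_mul_chiS (D : ChiData (pmSet a ha)) {N : ℤ}
    (hN : ∀ w, D.chi a (expU w) = expU ((2 * N + 1) * ((w - conj w) / 2))) (l : ℂ ⊗[ℤ] X) (k : X)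
    (y : AVCover a) :
    polarChar (l - (2 * N + 1 : ℂ) • half a) (k - N • a) y.1.1 * chiS a ha D (coverEquiv ha y) =
      y.1.2 * polarChar l k y.1.1 := by
  rw [chiS_coverEquiv D hN, mul_left_comm,
    polarChar_sub_smul_half l k a _ N (ha.norm_apply (AVCover.mem_RPoints y))]

/-- Division of a Langlands parameter by `r_p` gives a continuous cocycle. -/
theorem isCocycle1_div_rp {p : Gauge (pmSet a ha)} (D : ChiData (pmSet a ha))
    (C : ParamChoice (pmSet a ha) p) {φ : Weil →* EGroup a ha} (hφ : IsLParameter φ) :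
    IsCocycle1 fun w => (φ w).left / rp D C w := by
  refine ⟨?_, fun w w' => ?_⟩
  · refine CharGrp.continuous_of_apply fun ξ => ?_
    simp only [CharGrp.div_apply]
    exact ((CharGrp.continuous_apply ξ).comp (Tw.continuous_left.comp hφ.1)).div'
      ((CharGrp.continuous_apply ξ).comp (continuous_rp D C))
  · beta_reduce
    rw [map_mul, Tw.mul_left, hφ.2, hφ.2, cyclicCocycle_eq_titsCocycle p,
      rp_mul D C (titsCocycle_cc_cc p), mul_div_mul_right_eq_div, mul_div_mul_comm, smul_div']

/-- The two correspondences agree, for any χ-data and choices. From right to left, the differential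
`l`, `m` of the torus parameter `t` is found from that of `φ`. -/
theorem avCorr_iff_pmCorrWith [Module.Free ℤ X] [Module.Finite ℤ X]
    (p : Gauge (pmSet a ha)) (θ : PMCover a →* ℂˣ) {φ : Weil →* EGroup a ha}
    (hφ : IsLParameter φ) (D : ChiData (pmSet a ha)) (C : ParamChoice (pmSet a ha) p) :
    AVCorr a ha (θ.comp (coverEquiv ha : AVCover a →* PMCover a)) φ ↔
      PMCorrWith a ha p D C θ ((lGroupEquiv p : EGroup a ha →* LGroup (pmSet a ha) p).comp φ) := by
  obtain ⟨N, hN⟩ := exists_odd_of_sign_character (D.chi a) (D.cont a (mem_pmSet a ha))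
    (D.real a (mem_pmSet a ha))
  obtain ⟨c, hc⟩ := exists_rp_wj_eq_expDual D C
  constructor
  · rintro ⟨l, m, k, hz, hj, hk, hθ⟩
    rw [isAVCharacter_iff ha _ hk] at hθ
    have hk' := one_tmul_sub_eq (m' := m - c • half a) ha N hk (by
      rw [map_sub, actC_smul, ha.actC_half]; module)
    have ht := isCocycle1_div_rp D C hφ
    refine ⟨(polarChar (l - (2 * N + 1 : ℂ) • half a) (k - N • a)).comp (RPoints X).subtype,
      fun w => (φ w).left / rp D C w, 1, (continuous_polarChar _ _).comp continuous_subtype_val,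
      (isTorusParameter_iff ht ?_ ?_ hk' _).mpr fun s => rfl, ?_, ?_⟩
    · intro w
      rw [hz, rp_wz_expU D C hN, ← expDual_sub]
      congr 1
      rw [map_sub]
      module
    · rw [hj, Tw.mk_mul, hc, smul_sub, expDual_sub]
      congr 1
      exact mul_one _
    · intro y
      obtain ⟨y, rfl⟩ := (coverEquiv ha).surjective y
      exact (hθ y).trans (polarChar_mul_chiS D hN l k y).symm
    · intro w
      rw [Tw.mk_inv, inv_one, Tw.mk_mul, Tw.mul_mk, smul_one, one_mul, one_mul, div_mul_cancel]
      exact Tw.ext rfl (hφ.2 w)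
  · rintro ⟨θ₀, t, d, -, ht, hθ, hφt⟩
    obtain ⟨l, m, k, hz, hj, hk⟩ := hφ.exists_differential
    refine ⟨l, m, k, hz, hj, hk, (isAVCharacter_iff ha _ hk).mpr fun y => ?_⟩
    obtain ⟨v', hv'⟩ := expDual_surjective d
    obtain ⟨v, hv⟩ : ∃ v : ℂ ⊗[ℤ] X, (2 * Real.pi * Complex.I : ℂ) • v = v' :=
      ⟨_, smul_inv_smul₀ Complex.two_pi_I_ne_zero v'⟩
    -- The conjugation by `d` contributes a coboundary to `t`.
    have hleft : ∀ w, t w = (φ w).left / (d / w.right • d) / rp D C w := fun w => by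
      have h1 : (φ w).left =
          ((⟨d, 1⟩ : LGroup (pmSet a ha) p) * ⟨t w * rp D C w, w.right⟩ * ⟨d, 1⟩⁻¹).left :=
        congrArg Tw.left (hφt w)
      rw [Tw.mk_inv, Tw.mk_mul, Tw.mul_mk] at h1
      rw [h1, smul_inv', eq_div_iff_mul_eq', eq_div_iff_mul_eq', div_eq_mul_inv]
      simp only [mul_assoc, mul_comm, mul_left_comm]
    have hk' := one_tmul_sub_eq (m' := m - (v - actC cc v) - c • half a) ha N hk (by
      rw [map_sub, map_sub, map_sub, actC_cc_actC_cc, actC_smul, ha.actC_half]; module)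
    have hθ₀ := (isTorusParameter_iff ht.1 (l := l - (2 * N + 1 : ℂ) • half a) (fun w => ?_) ?_ hk'
      θ₀).mp ht
    · have h1 := hθ (coverEquiv ha y)
      rw [hθ₀] at h1
      exact h1.trans (polarChar_mul_chiS D hN l k y)
    · have h1 : (wz (expU w)).right • d = d := one_smul _ d
      rw [hleft, h1, div_self', div_one, hz, rp_wz_expU D C hN, ← expDual_sub]
      congr 1
      rw [map_sub]
      module
    · have h1 : wj.right • d = cc • d := rfl
      rw [hleft, h1, hj, Tw.mk_mul, hc, smul_sub, expDual_sub, smul_sub, expDual_sub, smul_sub,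
        expDual_sub, ← actC_smul, hv, ← cc_smul_expDual, hv']
      congr 2
      exact mul_one _

end Comparison

/-! ### Existence of χ-data and of the auxiliary choices -/

section Existence

variable {X : Type*} [AddCommGroup X] [DistribMulAction Gam X] {a : X}

theorem unitPart_cc_smul (z : ℂˣ) : unitPart (cc • z) = (unitPart z)⁻¹ := by
  have h : unitPart z * unitPart (cc • z) = 1 := by
    rw [← map_mul]
    exact normGroup_le_ker_unitPart ⟨z, rfl⟩
  exact (inv_eq_of_mul_eq_one_right h).symm

theorem unitPart_realUnit (r : ℝˣ) : unitPart (realUnit r) = kappa r := by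
  apply Units.ext
  rw [unitPart_coe]
  change ((r : ℝ) : ℂ) / (‖((r : ℝ) : ℂ)‖ : ℂ) = _
  rw [Complex.norm_real, Real.norm_eq_abs, kappa]
  have h0 : ((r : ℝ) : ℂ) ≠ 0 := Complex.ofReal_ne_zero.mpr r.ne_zero
  split_ifs with h
  · rw [abs_of_pos h, div_self h0]
    rfl
  · rw [abs_of_nonpos (not_lt.mp h), Complex.ofReal_neg, div_neg, div_self h0]
    rfl

theorem kappa_inv (r : ℝˣ) : (kappa r)⁻¹ = kappa r := by
  rw [kappa]
  split_ifs <;> simp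

open Classical in
/-- The χ-data with `χ_a(z) = z / |z|`. -/
def stdChiData (ha : IsSymmetric a) : ChiData (pmSet a ha) where
  chi b := if b = a then unitPart else unitPart⁻¹
  cont b _ := by
    split_ifs
    · exact continuous_unitPart
    · exact continuous_unitPart.inv
  smul g b hb z := by
    rcases gam_cases g with rfl | rfl
    · rw [one_smul, inv_one, one_smul]
    · rcases mem_pmSet_iff.mp hb with rfl | rfl
      · rw [ha.cc_smul, if_neg ha.1, if_pos rfl, cc_inv, unitPart_cc_smul]
        rfl
      · rw [smul_neg, ha.cc_smul, neg_neg, if_neg ha.1, if_pos rfl, cc_inv, MonoidHom.inv_apply,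
          unitPart_cc_smul, inv_inv]
  neg b hb z := by
    rcases mem_pmSet_iff.mp hb with rfl | rfl
    · rw [if_neg ha.1, if_pos rfl]
      rfl
    · rw [neg_neg, if_neg ha.1, if_pos rfl, MonoidHom.inv_apply, inv_inv]
  real b _ r := by
    split_ifs
    · exact unitPart_realUnit r
    · rw [MonoidHom.inv_apply, unitPart_realUnit, kappa_inv]

theorem exists_paramChoice {ha : IsSymmetric a} (p : Gauge (pmSet a ha)) :
    Nonempty (ParamChoice (pmSet a ha) p) := by
  have h1 : ∀ b : X, (1 : Weil).right⁻¹ • b = b := fun b => by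
    change (1 : Gam)⁻¹ • b = b
    rw [inv_one, one_smul]
  rcases Int.units_eq_one_or (p.toFun a) with h | h
  · exact ⟨⟨a, mem_pmSet a ha, 1, stdReps, by rw [h1, h]⟩⟩
  · exact ⟨⟨-a, (pmSet a ha).neg_mem a (mem_pmSet a ha), 1, stdReps, by
      rw [h1, p.neg_gen, h, neg_neg]⟩⟩

end Existence

end RealTori
end

open RealTori in
theorem mainTheorem9 {X : Type*} [AddCommGroup X] [Module.Free ℤ X] [Module.Finite ℤ X]
    [DistribMulAction Gal(ℂ/ℝ) X] (a : X) (ha : IsSymmetric a) :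
    ∃ (e : AVCover a ≃ₜ* PMCover a)
      (f : ∀ p : Gauge (pmSet a ha), EGroup a ha ≃ₜ* LGroup (pmSet a ha) p),
      (∀ y : AVCover a, (e y).1 = (y.1.1, QuotientGroup.mk y.1.2)) ∧
      (∀ p (s : DualTorus X), f p ⟨s, 1⟩ = ⟨s, 1⟩) ∧
      (∀ p, f p (delta a ha) = ⟨1, cc⟩) ∧
      (∀ p x, (f p x).right = x.right) ∧
      (∀ p q, ∃ d : DualTorus X, ∀ x,
        gaugeChange (pmSet a ha) p q (f p x) = ⟨d, 1⟩ * f q x * ⟨d, 1⟩⁻¹) ∧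
      ∀ (p : Gauge (pmSet a ha)) (θ : PMCover a →* ℂˣ) (φ : Weil →* EGroup a ha),
        PMCover.IsGenuine θ → IsLParameter φ →
        (AVCorr a ha (θ.comp (e : AVCover a →* PMCover a)) φ ↔
          PMCorr a ha p θ ((f p : EGroup a ha →* LGroup (pmSet a ha) p).comp φ)) ∧
        ∀ (D : ChiData (pmSet a ha)) (C : ParamChoice (pmSet a ha) p),
          (AVCorr a ha (θ.comp (e : AVCover a →* PMCover a)) φ ↔
            PMCorrWith a ha p D C θ
              ((f p : EGroup a ha →* LGroup (pmSet a ha) p).comp φ)) := by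
  refine ⟨coverEquiv ha, lGroupEquiv, coverEquiv_apply ha, fun _ _ => rfl, fun _ => rfl,
    fun _ _ => rfl, fun p q => ⟨1, fun x => ?_⟩, fun p θ φ _ hφ => ⟨⟨fun h => ?_, ?_⟩,
    avCorr_iff_pmCorrWith p θ hφ⟩⟩
  · rw [gaugeChange, gaugeCochain_eq_one, mul_one, Tw.mk_inv, inv_one, Tw.mk_mul, Tw.mul_mk,
      smul_one, one_mul, one_mul]
    rfl
  · obtain ⟨C⟩ := exists_paramChoice p
    exact ⟨stdChiData ha, C, (avCorr_iff_pmCorrWith p θ hφ _ C).mp h⟩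
  · rintro ⟨D, C, h⟩
    exact (avCorr_iff_pmCorrWith p θ hφ D C).mpr h
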